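/- **Theorem 4.1 (stability theorem of bipath persistent homology).** *Setting.* Let $k$ be a field and $q\ge 0$ an integer. The *bipath poset* is $B=(\mathbb R\times\{1,2\})\sqcup\{\pm\infty\}$, where $x\le y$ if and only if $x=-\infty$, or $y=+\infty$, or $x=(s,i)$, $y=(t,i)$ with $s\le t$. For $\epsilon\ge0$ let $\Lambda_\epsilon\colon B\to B$ be given by $\Lambda_\epsilon(r,i)=(r+\epsilon,i)$ and $\Lambda_\epsilon(\pm\infty)=\pm\infty$. A *bipath function* on a topological space $X$ is a pair $f=(f_1,f_2)$ of (not necessarily continuous) maps $f_i\colon X\to(\mathbb R\times\{i\})\sqcup\{\pm\infty\}\subseteq B$ with $f_1^{-1}(\{-\infty\})=f_2^{-1}(\{-\infty\})$. Its sublevel sets are $(f\le-\infty)=f_1^{-1}(\{-\infty\})$, $(f\le+\infty)=X$ and $(f\le(r,i))=\{x\in X\mid f_i(x)\le (r,i)\}$. With the subspace topologies and the inclusions they form a functor from $B$ to topological spaces, and $V(f)=H_q((f\le\cdot);k)$ is the functor from $B$ to $k$-vector spaces obtained by applying singular homology. The bipath function $f$ is *tame* if $V(f)_b$ is finite-dimensional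 for every $b\in B$. Put $|b,b|_B=0$, $|(r,i),(s,i)|_B=|r-s|$, and $|b,b'|_B=\infty$ in all other cases, and $$\|f,g\|_B=\max\Big\{\sup_{x\in X}|f_1(x),g_1(x)|_B,\ \sup_{x\in X}|f_2(x),g_2(x)|_B\Big\}\in[0,\infty],$$ where a supremum over the empty set is $0$. An *interval* of $B$ is a nonempty subset $I$ that is convex ($p\le r\le q$ and $p,q\in I$ imply $r\in I$) and connected (any two elements of $I$ are joined by a finite sequence in $I$ whose consecutive elements are comparable). The *interval module* $k_I$ is $k$ at the points of $I$ and $0$ elsewhere, with identity maps between points of $I$ and zero maps otherwise. A *persistence diagram* $\mathscr B(V)$ of $V\colon B\to\mathrm{Vect}_k$ is a multiset of intervals, with finite multiplicities, such that $V\cong\bigoplus_{I\in\mathscr B(V)}k_I$. For $A\subseteq B$ nonempty, put $A^\uparrow=\{p\mid \exists a\in A,\ a\le p\}$, $A^\downarrow=\{p\mid\exists a\in A,\ p\le a\}$ and $\mathrm{Ex}_\epsilon(A)=\Lambda_\epsilon^{-1}(A)^\uparrow\cap\Lambda_\epsilon(A)^\downarrow$. An *$\epsilon$-matching* between multisets $\mathscr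 A,\mathscr A'$ of intervals is a bijection $\sigma$ from a sub-multiset of $\mathscr A$ to a sub-multiset of $\mathscr A'$ such that (i) for every unmatched element $I$ of $\mathscr A$ or of $\mathscr A'$, all structure maps $(k_I)_p\to(k_I)_{\Lambda_{2\epsilon}(p)}$, $p\in B$, are zero; (ii) if $\sigma(I)=J$, then $I\subseteq\mathrm{Ex}_\epsilon(J)$ and $J\subseteq\mathrm{Ex}_\epsilon(I)$. The *bottleneck distance* is $$d_{\mathrm B}(\mathscr A,\mathscr A')=\inf\{\epsilon\ge0\mid\text{there is an $\epsilon$-matching between $\mathscr A$ and $\mathscr A'$}\}\in[0,\infty],\qquad \inf\emptyset=\infty.$$ *Theorem.* Let $f=(f_1,f_2)$ and $g=(g_1,g_2)$ be tame bipath functions on a topological space $X$ such that $$f_1^{-1}(\{-\infty\})=f_2^{-1}(\{-\infty\})=g_1^{-1}(\{-\infty\})=g_2^{-1}(\{-\infty\}).$$ Then $V(f)$ and $V(g)$ have persistence diagrams, and for all persistence diagrams $\mathscr B(V(f))$ of $V(f)$ and $\mathscr B(V(g))$ of $V(g)$, $$d_{\mathrm B}\big(\mathscr B(V(f)),\mathscr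 B(V(g))\big)\le\|f,g\|_B.$$ -/

import Mathlib

open CategoryTheory CategoryTheory.Limits
open scoped NNReal ENNReal

universe u w

noncomputable section

namespace BipathPersistence

/-! ### Persistence modules, intervals, interval modules, persistence diagrams -/

/-- Intervals of a poset: nonempty convex connected subsets. -/
structure PosetInterval (P : Type*) [PartialOrder P] where
  carrier : Set P
  nonempty : carrier.Nonempty
  convex : ∀ p ∈ carrier, ∀ q ∈ carrier, ∀ r, p ≤ r → r ≤ q → r ∈ carrier
  connected : ∀ p ∈ carrier, ∀ q ∈ carrier,
    Relation.ReflTransGen (fun a b => a ∈ carrier ∧ b ∈ carrier ∧ (a ≤ b ∨ b ≤ a)) p q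

section IntervalModule

variable (k : Type u) [Field k] {P : Type*} [PartialOrder P]

open Classical in
/-- The value at `p` of the interval module of `I`: the field `k` if `p ∈ I`, and zero otherwise.
(`ULift` only moves `k` to the universe in which the homology groups live.) -/
def intervalFiber (I : PosetInterval P) (p : P) : Submodule k (ULift.{w} k) :=
  if p ∈ I.carrier then ⊤ else ⊥

lemma intervalFiber_of_mem (I : PosetInterval P) {p : P} (hp : p ∈ I.carrier) :
    intervalFiber.{u, w} k I p = ⊤ := if_pos hp

lemma intervalFiber_of_notMem (I : PosetInterval P) {p : P} (hp : p ∉ I.carrier) :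
    intervalFiber.{u, w} k I p = ⊥ := if_neg hp

open Classical in
/-- The structure map of the interval module of `I` from `p` to `q`: the identity of `k` if both
`p` and `q` lie in `I`, and zero otherwise. -/
def intervalMap (I : PosetInterval P) (p q : P) :
    intervalFiber.{u, w} k I p →ₗ[k] intervalFiber.{u, w} k I q :=
  if h : p ∈ I.carrier ∧ q ∈ I.carrier then
    Submodule.inclusion
      ((intervalFiber_of_mem k I h.1).trans (intervalFiber_of_mem k I h.2).symm).le
  else 0

lemma intervalMap_self (I : PosetInterval P) (p : P) :
    intervalMap.{u, w} k I p p = LinearMap.id := by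
  by_cases hp : p ∈ I.carrier
  · ext x
    simp [intervalMap, hp]
  · ext x
    have hx : (x : ULift.{w} k) = 0 :=
      (Submodule.mem_bot k).1 ((intervalFiber_of_notMem.{u, w} k I hp).le x.2)
    simp [intervalMap, hp, hx]

lemma intervalMap_comp (I : PosetInterval P) {p q r : P} (hpq : p ≤ q) (hqr : q ≤ r) :
    intervalMap.{u, w} k I p r = (intervalMap.{u, w} k I q r) ∘ₗ (intervalMap.{u, w} k I p q) := by
  by_cases hp : p ∈ I.carrier <;> by_cases hr : r ∈ I.carrier
  · have hq : q ∈ I.carrier := I.convex p hp r hr q hpq hqr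
    ext x
    simp [intervalMap, hp, hq, hr]
  all_goals
    ext x
    simp [intervalMap, hp, hr]

/-- The interval module `k_I` of an interval `I`. -/
def intervalModule (I : PosetInterval P) : P ⥤ ModuleCat.{max u w} k where
  obj p := ModuleCat.of k (intervalFiber.{u, w} k I p)
  map {p q} _ := ModuleCat.ofHom (intervalMap.{u, w} k I p q)
  map_id p := by rw [intervalMap_self]; rfl
  map_comp {p q r} f g := by
    rw [intervalMap_comp k I (leOfHom f) (leOfHom g)]; rfl

end IntervalModule

/-- A multiset of intervals of `P` in which every interval has finite multiplicity, given by its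
multiplicity function. -/
abbrev IntervalMultiset (P : Type*) [PartialOrder P] := PosetInterval P → ℕ

/-- The elements of a multiset of intervals: each interval is repeated according to its
multiplicity. -/
abbrev IntervalMultiset.Elem {P : Type*} [PartialOrder P] (A : IntervalMultiset P) :=
  Σ I : PosetInterval P, Fin (A I)

/-- Pointwise finite-dimensional persistence modules. -/
def IsPFD {k : Type u} [Field k] {P : Type*} [PartialOrder P] (V : P ⥤ ModuleCat.{max u w} k) :
    Prop :=
  ∀ p, Module.Finite k (V.obj p)

/-- `A` is the persistence diagram (barcode) of `V`: the persistence module `V` is isomorphic to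
the direct sum of the interval modules `k_I` with `I` running through the multiset `A`. -/
def IsPersistenceDiagram {k : Type u} [Field k] {P : Type} [PartialOrder P]
    (V : P ⥤ ModuleCat.{max u w} k) (A : IntervalMultiset P) : Prop :=
  Nonempty (V ≅ ∐ fun a : A.Elem => intervalModule.{u, w} k a.1)

/-! ### Actions of the nonnegative reals by translations, the bottleneck distance -/

/-- An action of the monoid of nonnegative reals on a poset by translations, i.e. by
order-preserving maps `h` with `p ≤ h p` for all `p`. -/
structure TranslationAction (P : Type*) [PartialOrder P] where
  act : ℝ≥0 → P → P
  monotone : ∀ ε, Monotone (act ε)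
  le_act : ∀ ε p, p ≤ act ε p
  act_zero : ∀ p, act 0 p = p
  act_add : ∀ ε ζ p, act (ε + ζ) p = act ε (act ζ p)

section Bottleneck

variable {P : Type*} [PartialOrder P] (L : TranslationAction P)

/-- `V` is `ε`-trivial: the canonical morphism from `V` to its `ε`-shift is zero. -/
def IsTrivial {k : Type u} [Field k] (ε : ℝ≥0) (V : P ⥤ ModuleCat.{max u w} k) : Prop :=
  ∀ p, V.map (homOfLE (L.le_act ε p)) = 0

/-- The upset generated by `A`, with the convention that the empty set generates all of `P`. -/
def upset (A : Set P) : Set P := {p | A.Nonempty → ∃ a ∈ A, a ≤ p}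

/-- The downset generated by `A`, with the convention that the empty set generates all of `P`. -/
def downset (A : Set P) : Set P := {p | A.Nonempty → ∃ a ∈ A, p ≤ a}

/-- The `ε`-thickening of a subset of `P`. -/
def thickening (ε : ℝ≥0) (A : Set P) : Set P :=
  upset (L.act ε ⁻¹' A) ∩ downset (L.act ε '' A)

/-- `σ` is an `ε`-matching between the multisets of intervals `A` and `B`. A partial matching, i.e.
a bijection from a subset of the elements of `A` to a subset of the elements of `B`, is a
`PEquiv`; `σ a = none` says that `a` is unmatched. -/
structure IsMatching (k : Type u) [Field k] (ε : ℝ≥0) {A B : IntervalMultiset P}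
    (σ : A.Elem ≃. B.Elem) : Prop where
  left_unmatched : ∀ a, σ a = none → IsTrivial L (2 * ε) (intervalModule.{u, w} k a.1)
  right_unmatched : ∀ b, σ.symm b = none → IsTrivial L (2 * ε) (intervalModule.{u, w} k b.1)
  matched : ∀ a b, σ a = some b →
    a.1.carrier ⊆ thickening L ε b.1.carrier ∧ b.1.carrier ⊆ thickening L ε a.1.carrier

/-- The bottleneck distance: the infimum in `[0, ∞]` of all `ε ≥ 0` such that there is an
`ε`-matching. -/
def bottleneckDist (k : Type u) [Field k] (A B : IntervalMultiset P) : ℝ≥0∞ :=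
  ⨅ (ε : ℝ≥0) (_ : ∃ σ : A.Elem ≃. B.Elem, IsMatching.{u, w} L k ε σ), (ε : ℝ≥0∞)

end Bottleneck

/-! ### The bipath poset -/

/-- The underlying set of the bipath poset: two copies of the real line (indexed by `Fin 2`),
together with `-∞` and `+∞`. -/
inductive Bipath : Type
  | negInf : Bipath
  | posInf : Bipath
  | pt (i : Fin 2) (r : ℝ) : Bipath

instance : PartialOrder Bipath where
  le x y := x = .negInf ∨ y = .posInf ∨ ∃ i s t, x = .pt i s ∧ y = .pt i t ∧ s ≤ t
  le_refl x := by
    cases x with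
    | negInf => exact .inl rfl
    | posInf => exact .inr (.inl rfl)
    | pt i r => exact .inr (.inr ⟨i, r, r, rfl, rfl, le_rfl⟩)
  le_trans x y z := by
    rintro (rfl | rfl | ⟨i, s, t, rfl, rfl, h⟩) (h' | rfl | ⟨j, s', t', h1, rfl, h'⟩)
    all_goals first
      | exact .inl rfl
      | exact .inr (.inl rfl)
      | simp_all
    exact h.trans h'
  le_antisymm x y := by
    rintro (rfl | rfl | ⟨i, s, t, rfl, rfl, h⟩) (h' | h' | ⟨j, s', t', h1, h2, h'⟩)
    all_goals simp_all
    exact le_antisymm h h'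

lemma Bipath.le_def {x y : Bipath} : x ≤ y ↔
    x = .negInf ∨ y = .posInf ∨ ∃ i s t, x = .pt i s ∧ y = .pt i t ∧ s ≤ t := Iff.rfl

/-- The translation of the bipath poset by `ε`, which fixes `-∞` and `+∞`. -/
def bipathShift (ε : ℝ≥0) : Bipath → Bipath
  | .negInf => .negInf
  | .posInf => .posInf
  | .pt i r => .pt i (r + ε)

/-- The action of the nonnegative reals on the bipath poset by translations. -/
def bipathAction : TranslationAction Bipath where
  act := bipathShift
  monotone ε := by
    rintro x y (rfl | rfl | ⟨i, s, t, rfl, rfl, h⟩)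
    · exact .inl rfl
    · exact .inr (.inl rfl)
    · exact .inr (.inr ⟨i, _, _, rfl, rfl, by gcongr⟩)
  le_act ε p := by
    cases p with
    | negInf => exact .inl rfl
    | posInf => exact .inr (.inl rfl)
    | pt i r => exact .inr (.inr ⟨i, _, _, rfl, rfl, by simp⟩)
  act_zero p := by cases p <;> simp [bipathShift]
  act_add ε ζ p := by
    cases p with
    | negInf => rfl
    | posInf => rfl
    | pt i r => simp only [bipathShift, NNReal.coe_add]; congr 1; ring

/-- The extended distance between two elements of the bipath poset: `|r - s|` on each of the two
real lines, `0` between equal elements, and `∞` in all other cases. -/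
def bipathDist : Bipath → Bipath → ℝ≥0∞
  | .negInf, .negInf => 0
  | .posInf, .posInf => 0
  | .pt i r, .pt j s => if i = j then ENNReal.ofReal |r - s| else ⊤
  | _, _ => ⊤

/-! ### Bipath functions and bipath persistent homology -/

/-- A bipath function on `X`: a pair of maps `f 0`, `f 1` to the bipath poset, the `i`-th one with
values in the `i`-th real line or `±∞`, with the same level set at `-∞`. -/
structure BipathFunction (X : Type*) where
  toFun : Fin 2 → X → Bipath
  range_subset : ∀ i x,
    toFun i x = .negInf ∨ toFun i x = .posInf ∨ ∃ r, toFun i x = .pt i r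
  negInf_eq : toFun 0 ⁻¹' {.negInf} = toFun 1 ⁻¹' {.negInf}

namespace BipathFunction

section Sublevel

variable {X : Type*} (f g : BipathFunction X)

/-- The sublevel set `(f ≤ b)`. -/
def sublevel : Bipath → Set X
  | .negInf => f.toFun 0 ⁻¹' {.negInf}
  | .posInf => Set.univ
  | .pt i r => {x | f.toFun i x ≤ .pt i r}

lemma sublevel_mono : Monotone f.sublevel := by
  have key : ∀ i x, x ∈ f.sublevel .negInf → f.toFun i x = .negInf := by
    intro i x hx
    have hx' : x ∈ f.toFun 1 ⁻¹' {.negInf} := f.negInf_eq ▸ hx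
    fin_cases i
    · exact hx
    · exact hx'
  rintro a b (rfl | rfl | ⟨i, s, t, rfl, rfl, h⟩) x hx
  · cases b with
    | negInf => exact hx
    | posInf => trivial
    | pt i r => exact Or.inl (key i x hx)
  · trivial
  · exact le_trans (show f.toFun i x ≤ .pt i s from hx) (.inr (.inr ⟨i, s, t, rfl, rfl, h⟩))

/-- The extended sup-distance `‖f, g‖` between two bipath functions. -/
def dist : ℝ≥0∞ :=
  max (⨆ x, bipathDist (f.toFun 0 x) (g.toFun 0 x)) (⨆ x, bipathDist (f.toFun 1 x) (g.toFun 1 x))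

end Sublevel

variable {X : Type w} [TopologicalSpace X] (f : BipathFunction X)

/-- The sublevelset bipath filtration of `f`: the sublevel sets with the subspace topology and the
inclusions between them. -/
def filtration : Bipath ⥤ TopCat.{w} where
  obj b := TopCat.of (f.sublevel b)
  map {_ _} h := TopCat.ofHom
    ⟨Set.inclusion (f.sublevel_mono (leOfHom h)), continuous_inclusion _⟩
  map_id _ := rfl
  map_comp _ _ := rfl

/-- The `q`-th bipath persistent homology of `f` with coefficients in `k`: singular homology
applied to the sublevelset bipath filtration. -/
def persistentHomology (k : Type u) [Field k] (q : ℕ) : Bipath ⥤ ModuleCat.{max u w} k :=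
  f.filtration ⋙
    (AlgebraicTopology.singularHomologyFunctor (ModuleCat.{max u w} k) q).obj
      (ModuleCat.of k (ULift.{w} k))

/-- `f` is tame (in degree `q`, over `k`): its bipath persistent homology is pointwise
finite-dimensional. -/
def Tame (k : Type u) [Field k] (q : ℕ) : Prop :=
  IsPFD.{u, w} (f.persistentHomology k q)

end BipathFunction

end BipathPersistence

end

noncomputable section

namespace BipathPersistence

/-! ### Linear algebra -/

section LinearAlgebra

variable {k : Type*} [Field k]

/-- Two chains of subspaces of a nonzero finite-dimensional vector space admit a line and a
complementary hyperplane such that every member of the chains contains the line or lies in the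
hyperplane. -/
theorem exists_vector_dual_of_isChain {V : Type*} [AddCommGroup V] [Module k V]
    [Module.Finite k V] [Nontrivial V] {C D : Set (Submodule k V)}
    (hC : IsChain (· ≤ ·) C) (hD : IsChain (· ≤ ·) D) :
    ∃ (x : V) (θ : Module.Dual k V), θ x = 1 ∧
      (∀ N ∈ C, x ∈ N ∨ N ≤ LinearMap.ker θ) ∧ (∀ N ∈ D, x ∈ N ∨ N ≤ LinearMap.ker θ) := by
  -- `Q` is the largest proper member of `C`. Any `θ` vanishing on `Q` and any `x` settle the
  -- condition for `C`.
  obtain ⟨Q, hQ, hQC⟩ : ∃ Q : Submodule k V, Q ≠ ⊤ ∧ ∀ N ∈ C, N = ⊤ ∨ N ≤ Q := by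
    by_cases h : ({N ∈ C | N ≠ ⊤}).Nonempty
    · obtain ⟨Q, hQ, hmax⟩ := WellFounded.has_min
        (wellFounded_gt (α := Submodule k V)) _ h
      refine ⟨Q, hQ.2, fun N hN => or_iff_not_imp_left.2 fun hN' => ?_⟩
      rcases eq_or_ne N Q with rfl | hne
      · exact le_rfl
      · rcases hC hN hQ.1 hne with h1 | h1
        · exact h1
        · exact absurd (lt_of_le_of_ne h1 hne.symm) (hmax N ⟨hN, hN'⟩)
    · refine ⟨⊥, bot_ne_top, fun N hN => .inl ?_⟩
      by_contra hN'
      exact h ⟨N, hN, hN'⟩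
  -- `N₀` is the smallest member of `D` not inside `Q`, with `⊤` as a fallback. A vector of `N₀`
  -- outside `Q` lies in every member of `D` that is not inside `Q`.
  obtain ⟨N₀, hN₀, hmin⟩ := WellFounded.has_min (wellFounded_lt (α := Submodule k V))
    {N | (N ∈ D ∨ N = ⊤) ∧ ¬ N ≤ Q} ⟨⊤, .inr rfl, fun h => hQ (top_le_iff.1 h)⟩
  obtain ⟨x, hx, hxQ⟩ := Set.not_subset.1 hN₀.2
  obtain ⟨θ, hθx, hθ⟩ := Submodule.exists_dual_map_eq_bot_of_notMem (p := Q) hxQ inferInstance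
  have hθQ : Q ≤ LinearMap.ker θ := LinearMap.le_ker_iff_map.2 hθ
  refine ⟨x, (θ x)⁻¹ • θ, by simp [hθx], fun N hN => ?_, fun N hN => ?_⟩
  · rcases hQC N hN with rfl | h
    · exact .inl trivial
    · exact .inr fun y hy => by simp [LinearMap.mem_ker.1 (hθQ (h hy))]
  · by_cases h : N ≤ Q
    · exact .inr fun y hy => by simp [LinearMap.mem_ker.1 (hθQ (h hy))]
    · left
      have hcomp : N ≤ N₀ ∨ N₀ ≤ N := by
        rcases hN₀.1 with h' | rfl
        · rcases eq_or_ne N N₀ with rfl | hne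
          · exact .inl le_rfl
          · exact hD hN h' hne
        · exact .inl le_top
      rcases hcomp with h1 | h1
      · rcases h1.eq_or_lt with rfl | h2
        · exact hx
        · exact absurd h2 (hmin N ⟨.inl hN, h⟩)
      · exact h1 hx

/-- A functional on one member of a directed system which vanishes on the kernels of the transition
maps extends to a compatible family of functionals. -/
theorem exists_compatible_duals {ι : Type*} [Preorder ι] [IsDirectedOrder ι] (G : ι → Type*)
    [∀ i, AddCommGroup (G i)] [∀ i, Module k (G i)] (f : ∀ i j, i ≤ j → G i →ₗ[k] G j)
    [DirectedSystem G fun i j h => f i j h] (i₀ : ι) (θ : Module.Dual k (G i₀))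
    (hθ : ∀ i (h : i₀ ≤ i), LinearMap.ker (f i₀ i h) ≤ LinearMap.ker θ) :
    ∃ η : ∀ i, Module.Dual k (G i), η i₀ = θ ∧ ∀ i j (h : i ≤ j) x, η j (f i j h x) = η i x := by
  classical
  have : Nonempty ι := ⟨i₀⟩
  -- The kernel of the map to the direct limit is the union of the kernels of the transition maps,
  -- so `θ` factors through the limit.
  have hmem : θ ∈ LinearMap.range (Module.DirectLimit.of k ι G f i₀).dualMap := by
    rw [LinearMap.range_dualMap_eq_dualAnnihilator_ker, Submodule.mem_dualAnnihilator]
    intro x hx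
    obtain ⟨j, hj, hxj⟩ := Module.DirectLimit.of.zero_exact (LinearMap.mem_ker.1 hx)
    exact hθ j hj hxj
  obtain ⟨l, hl⟩ := hmem
  refine ⟨fun i => l ∘ₗ Module.DirectLimit.of k ι G f i, hl, fun i j h x => ?_⟩
  simp

/-- An element of one member of a codirected system of finite-dimensional vector spaces which lies
in the images of the transition maps lifts to a compatible family of elements. -/
theorem exists_compatible_vectors {ι : Type*} [Preorder ι] [IsCodirectedOrder ι] (G : ι → Type*)
    [∀ i, AddCommGroup (G i)] [∀ i, Module k (G i)] [∀ i, Module.Finite k (G i)]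
    (f : ∀ i j, i ≤ j → G i →ₗ[k] G j)
    [DirectedSystem G fun i j h => f i j h] (i₀ : ι) (x : G i₀)
    (hx : ∀ i (h : i ≤ i₀), x ∈ LinearMap.range (f i i₀ h)) :
    ∃ y : ∀ i, G i, y i₀ = x ∧ ∀ i j (h : i ≤ j), f i j h (y i) = y j := by
  -- Dualizing turns the inverse system into a direct one; finite dimension brings the resulting
  -- functionals on the duals back as vectors.
  let G' : ιᵒᵈ → Type _ := fun i => Module.Dual k (G (OrderDual.ofDual i))
  let f' : ∀ i j : ιᵒᵈ, i ≤ j → G' i →ₗ[k] G' j := fun i j h =>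
    (f (OrderDual.ofDual j) (OrderDual.ofDual i) h).dualMap
  have : DirectedSystem G' fun i j h => f' i j h :=
    { map_self := fun i φ => by
        ext v
        exact congrArg φ (DirectedSystem.map_self (f := fun i j h => f i j h) v)
      map_map := fun i j l hij hjl φ => by
        ext v
        exact congrArg φ (DirectedSystem.map_map (f := fun i j h => f i j h) hjl hij v) }
  obtain ⟨η, hη, hη'⟩ := exists_compatible_duals G' f' (OrderDual.toDual i₀)
    (Module.Dual.eval k (G i₀) x) (by
      intro i h φ hφ
      obtain ⟨v, hv⟩ := hx (OrderDual.ofDual i) h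
      have h1 : φ (f (OrderDual.ofDual i) i₀ h v) = 0 :=
        LinearMap.congr_fun (LinearMap.mem_ker.1 hφ) v
      rw [hv] at h1
      exact h1)
  have hy : ∀ i, ∃ y : G i, ∀ φ : Module.Dual k (G i), η (OrderDual.toDual i) φ = φ y := by
    intro i
    obtain ⟨y, hy⟩ := (Module.evalEquiv k (G i)).surjective (η (OrderDual.toDual i))
    exact ⟨y, fun φ => (LinearMap.congr_fun hy φ).symm⟩
  choose y hy using hy
  refine ⟨y, sub_eq_zero.1 <| (Module.forall_dual_apply_eq_zero_iff k _).1 fun φ => ?_, fun i j h =>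
    sub_eq_zero.1 <| (Module.forall_dual_apply_eq_zero_iff k _).1 fun φ => ?_⟩
  · rw [map_sub, sub_eq_zero, ← hy, hη]
    rfl
  · rw [map_sub, sub_eq_zero, ← hy j φ, ← hη' (OrderDual.toDual j) (OrderDual.toDual i) h φ]
    exact (hy i (φ ∘ₗ f i j h)).symm

end LinearAlgebra

/-! ### Interval summands -/

section Frame

universe v

variable {k : Type u} [Field k] {P : Type*} [PartialOrder P]

/-- The structure map of a persistence module as a linear map. -/
def transition (V : P ⥤ ModuleCat.{v} k) {p q : P} (h : p ≤ q) : V.obj p →ₗ[k] V.obj q :=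
  (V.map (homOfLE h)).hom

@[simp]
lemma transition_self (V : P ⥤ ModuleCat.{v} k) {p : P} (h : p ≤ p) (x : V.obj p) :
    transition V h x = x := by
  simp [transition]

@[simp]
lemma transition_transition (V : P ⥤ ModuleCat.{v} k) {p q r : P} (h : p ≤ q) (h' : q ≤ r)
    (x : V.obj p) : transition V h' (transition V h x) = transition V (h.trans h') x := by
  have : V.map (homOfLE (h.trans h')) = V.map (homOfLE h) ≫ V.map (homOfLE h') := by
    rw [← V.map_comp]
    rfl
  exact (LinearMap.congr_fun (congrArg ModuleCat.Hom.hom this) x).symm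

/-- A direct summand of `V` isomorphic to the interval module of `I`, given by the images of the
generators under the inclusion and by the coordinates of the projection. -/
structure Frame (V : P ⥤ ModuleCat.{v} k) (I : PosetInterval P) where
  vec : ∀ p, V.obj p
  fn : ∀ p, Module.Dual k (V.obj p)
  vec_eq_zero : ∀ p, p ∉ I.carrier → vec p = 0
  fn_eq_zero : ∀ p, p ∉ I.carrier → fn p = 0
  transition_vec : ∀ p q (h : p ≤ q), p ∈ I.carrier → transition V h (vec p) = vec q
  fn_transition : ∀ p q (h : p ≤ q), q ∈ I.carrier → ∀ x, fn q (transition V h x) = fn p x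
  fn_vec : ∀ p, p ∈ I.carrier → fn p (vec p) = 1

/-- The interval cut out by a vector `x` of `V.obj p₀`: the points below `p₀` to which `x` lifts
and the points above `p₀` where `x` does not vanish. -/
def vectorSupport (V : P ⥤ ModuleCat.{v} k) (p₀ : P) (x : V.obj p₀) : Set P :=
  {p | (∃ h : p₀ ≤ p, transition V h x ≠ 0) ∨ ∃ h : p ≤ p₀, x ∈ LinearMap.range (transition V h)}

/-- A vector and a functional at `p₀` which are compatible with all images and kernels at `p₀`,
together with compatible extensions to smaller and larger points, give an interval summand. -/
theorem exists_frame (V : P ⥤ ModuleCat.{v} k) (p₀ : P) (x : V.obj p₀)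
    (θ : Module.Dual k (V.obj p₀)) (hθx : θ x = 1)
    (hcomp : ∀ p q, p ≤ q → Nontrivial (V.obj p) → Nontrivial (V.obj q) →
      (p ≤ p₀ ∨ p₀ ≤ p ↔ q ≤ p₀ ∨ p₀ ≤ q))
    (hker : ∀ p (h : p₀ ≤ p),
      transition V h x = 0 ∨ LinearMap.ker (transition V h) ≤ LinearMap.ker θ)
    (hrange : ∀ p (h : p ≤ p₀),
      x ∈ LinearMap.range (transition V h) ∨ LinearMap.range (transition V h) ≤ LinearMap.ker θ)
    (y : ∀ p, V.obj p) (hy₀ : y p₀ = x)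
    (hy : ∀ p q (h : p ≤ q) (h' : q ≤ p₀), x ∈ LinearMap.range (transition V (h.trans h')) →
      transition V h (y p) = y q)
    (η : ∀ p, Module.Dual k (V.obj p)) (hη₀ : η p₀ = θ)
    (hη : ∀ p q (h : p₀ ≤ p) (h' : p ≤ q), transition V (h.trans h') x ≠ 0 →
      ∀ z, η q (transition V h' z) = η p z) :
    ∃ I, Nonempty (Frame V I) := by
  classical
  have hx : x ≠ 0 := by rintro rfl; simp at hθx
  set S := vectorSupport V p₀ x with hS
  have hp₀ : p₀ ∈ S := .inl ⟨le_rfl, by simpa using hx⟩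
  have hup : ∀ p (h : p₀ ≤ p), p ∈ S ↔ transition V h x ≠ 0 := by
    intro p h
    refine ⟨?_, fun h' => .inl ⟨h, h'⟩⟩
    rintro (⟨_, h'⟩ | ⟨h2, -⟩)
    · exact h'
    · obtain rfl := le_antisymm h h2
      simpa using hx
  have hdown : ∀ p (h : p ≤ p₀), p ∈ S ↔ x ∈ LinearMap.range (transition V h) := by
    intro p h
    refine ⟨?_, fun h' => .inr ⟨h, h'⟩⟩
    rintro (⟨h2, -⟩ | ⟨_, h'⟩)
    · obtain rfl := le_antisymm h h2
      exact ⟨x, by simp⟩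
    · exact h'
  have hcompS : ∀ p ∈ S, p₀ ≤ p ∨ p ≤ p₀ := by
    rintro p (⟨h, -⟩ | ⟨h, -⟩)
    exacts [.inl h, .inr h]
  have hnt : ∀ p ∈ S, Nontrivial (V.obj p) := by
    rintro p (⟨h, h'⟩ | ⟨h, z, hz⟩)
    · exact ⟨_, _, h'⟩
    · refine ⟨z, 0, ?_⟩
      rintro rfl
      exact hx (by simpa using hz.symm)
  -- The critical case is `p ≤ p₀ ≤ q`, where `r` might be incomparable to `p₀`. The space at `r` is
  -- nonzero, since `x` lifts to `p` and survives to `q`, so `hcomp` applies.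
  have hconv : ∀ p ∈ S, ∀ q ∈ S, ∀ r, p ≤ r → r ≤ q → r ∈ S := by
    intro p hp q hq r hpr hrq
    have hr : p₀ ≤ r ∨ r ≤ p₀ := by
      rcases hcompS p hp with hp' | hp'
      · exact .inl (hp'.trans hpr)
      rcases hcompS q hq with hq' | hq'
      · obtain ⟨z, hz⟩ := (hdown p hp').1 hp
        have hne := (hup q hq').1 hq
        have hr : Nontrivial (V.obj r) := by
          refine ⟨transition V hpr z, 0, fun h0 => hne ?_⟩
          rw [← hz, transition_transition, ← transition_transition V hpr hrq, h0, map_zero]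
        exact ((hcomp p r hpr (hnt p hp) hr).1 (.inl hp')).symm
      · exact .inr (hrq.trans hq')
    rcases hr with hr | hr
    · rw [hup r hr]
      intro h0
      refine (hup q (hr.trans hrq)).1 hq ?_
      rw [← transition_transition V hr hrq, h0, map_zero]
    · rw [hdown r hr]
      obtain ⟨z, hz⟩ := (hdown p (hpr.trans hr)).1 hp
      exact ⟨transition V hpr z, by rw [transition_transition, hz]⟩
  have hconn : ∀ p ∈ S, ∀ q ∈ S,
      Relation.ReflTransGen (fun a b => a ∈ S ∧ b ∈ S ∧ (a ≤ b ∨ b ≤ a)) p q := by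
    intro p hp q hq
    exact .tail (.single ⟨hp, hp₀, (hcompS p hp).symm⟩) ⟨hp₀, hq, hcompS q hq⟩
  have hyS : ∀ p (h : p₀ ≤ p), p ∈ S → p ≤ p₀ → y p = transition V h x := by
    intro p h _ h2
    obtain rfl := le_antisymm h h2
    simp [hy₀]
  have hηS : ∀ p (h : p ≤ p₀), p₀ ≤ p → η p = θ ∘ₗ transition V h := by
    intro p h h2
    obtain rfl := le_antisymm h h2
    ext z
    simp [hη₀]
  -- Above `p₀` the vector is pushed forward and below it is a chosen lift; dually, the functional
  -- is pulled back below and extended above.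
  let vec : ∀ p, V.obj p := fun p =>
    if p ∈ S then (if h : p₀ ≤ p then transition V h x else y p) else 0
  let fn : ∀ p, Module.Dual k (V.obj p) := fun p =>
    if p ∈ S then (if h : p ≤ p₀ then θ ∘ₗ transition V h else η p) else 0
  have hvec_up : ∀ p (h : p₀ ≤ p), vec p = transition V h x := by
    intro p h
    by_cases hp : p ∈ S
    · simp [vec, hp, h]
    · simpa [vec, hp] using (not_not.1 (mt (hup p h).2 hp)).symm
  have hvec_down : ∀ p, p ≤ p₀ → p ∈ S → vec p = y p := by
    intro p h hp
    by_cases h2 : p₀ ≤ p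
    · simp [vec, hp, h2, hyS p h2 hp h]
    · simp [vec, hp, h2]
  have hfn_down : ∀ p (h : p ≤ p₀), fn p = θ ∘ₗ transition V h := by
    intro p h
    by_cases hp : p ∈ S
    · simp [fn, hp, h]
    · have h0 := (hrange p h).resolve_left (mt (hdown p h).2 hp)
      ext z
      simpa [fn, hp] using (LinearMap.mem_ker.1 (h0 ⟨z, rfl⟩)).symm
  have hfn_up : ∀ p, p₀ ≤ p → p ∈ S → fn p = η p := by
    intro p h hp
    by_cases h2 : p ≤ p₀
    · simp [fn, hp, h2, hηS p h2 h]
    · simp [fn, hp, h2]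
  have hvec_off : ∀ p, p ∉ S → vec p = 0 := fun p hp => by simp [vec, hp]
  have hfn_off : ∀ p, p ∉ S → fn p = 0 := fun p hp => by simp [fn, hp]
  have hfn_p₀ : fn p₀ = θ := by
    ext z
    simp [hfn_down p₀ le_rfl]
  have hvec_p₀ : vec p₀ = x := by simp [hvec_up p₀ le_rfl]
  have h_vec : ∀ p q (h : p ≤ q), p ∈ S → transition V h (vec p) = vec q := by
    intro p q h hp
    rcases hcompS p hp with hp' | hp'
    · rw [hvec_up p hp', hvec_up q (hp'.trans h), transition_transition]
    · by_cases hq : q ≤ p₀ ∨ p₀ ≤ q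
      · have hxp := (hdown p hp').1 hp
        rcases hq with hq | hq
        · have hqS : q ∈ S := by
            rw [hdown q hq]
            obtain ⟨z, hz⟩ := hxp
            exact ⟨transition V h z, by rw [transition_transition, hz]⟩
          rw [hvec_down p hp' hp, hvec_down q hq hqS, hy p q h hq hxp]
        · rw [hvec_down p hp' hp, hvec_up q hq, ← transition_transition V hp' hq,
            hy p p₀ hp' le_rfl hxp, hy₀]
      · have : Subsingleton (V.obj q) := by
          by_contra hq'
          rw [not_subsingleton_iff_nontrivial] at hq'
          exact hq ((hcomp p q h (hnt p hp) hq').1 (.inl hp'))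
        exact Subsingleton.elim _ _
  have h_fn : ∀ p q (h : p ≤ q), q ∈ S → ∀ z, fn q (transition V h z) = fn p z := by
    intro p q h hq z
    rcases hcompS q hq with hq' | hq'
    · by_cases hp : p ≤ p₀ ∨ p₀ ≤ p
      · have hxq := (hup q hq').1 hq
        rcases hp with hp | hp
        · rw [hfn_up q hq' hq, hfn_down p hp, ← transition_transition V hp hq',
            hη p₀ q le_rfl hq' hxq, hη₀]
          rfl
        · have hpS : p ∈ S := by
            rw [hup p hp]
            intro h0
            refine hxq ?_
            rw [← transition_transition V hp h, h0, map_zero]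
          rw [hfn_up q hq' hq, hfn_up p hp hpS, hη p q hp h hxq]
      · have : Subsingleton (V.obj p) := by
          by_contra hp'
          rw [not_subsingleton_iff_nontrivial] at hp'
          exact hp ((hcomp p q h hp' (hnt q hq)).2 (.inr hq'))
        rw [Subsingleton.elim z 0]
        simp
    · rw [hfn_down q hq', hfn_down p (h.trans hq')]
      simp
  have h_one : ∀ p, p ∈ S → fn p (vec p) = 1 := by
    intro p hp
    rcases hcompS p hp with hp' | hp'
    · rw [← h_vec p₀ p hp' hp₀, h_fn p₀ p hp' hp, hfn_p₀, hvec_p₀, hθx]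
    · rw [← h_fn p p₀ hp' hp₀, h_vec p p₀ hp' hp, hfn_p₀, hvec_p₀, hθx]
  exact ⟨⟨S, ⟨p₀, hp₀⟩, hconv, hconn⟩, ⟨⟨vec, fn, hvec_off, hfn_off, h_vec, h_fn, h_one⟩⟩⟩

end Frame

section FrameExistence

universe v

variable {k : Type u} [Field k] {P : Type*} [PartialOrder P]

lemma exists_compatible_duals_on (V : P ⥤ ModuleCat.{v} k) {D : Set P}
    (hD : DirectedOn (· ≤ ·) D) {p₀ : P} (hp₀ : p₀ ∈ D) (θ : Module.Dual k (V.obj p₀))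
    (hθ : ∀ p ∈ D, ∀ h : p₀ ≤ p, LinearMap.ker (transition V h) ≤ LinearMap.ker θ) :
    ∃ η : ∀ p, Module.Dual k (V.obj p), η p₀ = θ ∧
      ∀ p ∈ D, ∀ q ∈ D, ∀ (h : p ≤ q) z, η q (transition V h z) = η p z := by
  classical
  have : IsDirectedOrder D := ⟨fun a b => by
    obtain ⟨c, hc, h1, h2⟩ := hD a a.2 b b.2
    exact ⟨⟨c, hc⟩, h1, h2⟩⟩
  have : DirectedSystem (fun p : D => V.obj p)
      fun i j (h : i ≤ j) => transition V (show (i : P) ≤ j from h) :=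
    { map_self := fun i x => transition_self V _ x
      map_map := fun i j l h h' x => transition_transition V _ _ x }
  obtain ⟨η, h0, h1⟩ := exists_compatible_duals (fun p : D => V.obj p)
    (fun i j (h : i ≤ j) => transition V (show (i : P) ≤ j from h)) ⟨p₀, hp₀⟩ θ
    (fun i h => hθ i i.2 h)
  refine ⟨fun p => if h : p ∈ D then η ⟨p, h⟩ else 0, by simp [hp₀, h0], ?_⟩
  intro p hp q hq h z
  simpa [hp, hq] using h1 ⟨p, hp⟩ ⟨q, hq⟩ h z

lemma exists_compatible_vectors_on (V : P ⥤ ModuleCat.{v} k) [∀ p, Module.Finite k (V.obj p)]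
    {D : Set P} (hD : DirectedOn (· ≥ ·) D) {p₀ : P} (hp₀ : p₀ ∈ D) (x : V.obj p₀)
    (hx : ∀ p ∈ D, ∀ h : p ≤ p₀, x ∈ LinearMap.range (transition V h)) :
    ∃ y : ∀ p, V.obj p, y p₀ = x ∧
      ∀ p ∈ D, ∀ q ∈ D, ∀ h : p ≤ q, transition V h (y p) = y q := by
  classical
  have : IsCodirectedOrder D := ⟨fun a b => by
    obtain ⟨c, hc, h1, h2⟩ := hD a a.2 b b.2
    exact ⟨⟨c, hc⟩, h1, h2⟩⟩
  have : DirectedSystem (fun p : D => V.obj p)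
      fun i j (h : i ≤ j) => transition V (show (i : P) ≤ j from h) :=
    { map_self := fun i x => transition_self V _ x
      map_map := fun i j l h h' x => transition_transition V _ _ x }
  obtain ⟨y, h0, h1⟩ := exists_compatible_vectors (fun p : D => V.obj p)
    (fun i j (h : i ≤ j) => transition V (show (i : P) ≤ j from h)) ⟨p₀, hp₀⟩ x
    (fun i h => hx i i.2 h)
  refine ⟨fun p => if h : p ∈ D then y ⟨p, h⟩ else 0, by simp [hp₀, h0], ?_⟩
  intro p hp q hq h
  simpa [hp, hq] using h1 ⟨p, hp⟩ ⟨q, hq⟩ h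

lemma ker_transition_mono (V : P ⥤ ModuleCat.{v} k) {p q r : P} (h : p ≤ q) (h' : q ≤ r) :
    LinearMap.ker (transition V h) ≤ LinearMap.ker (transition V (h.trans h')) := by
  intro x hx
  rw [LinearMap.mem_ker] at hx ⊢
  rw [← transition_transition V h h', hx, map_zero]

lemma range_transition_mono (V : P ⥤ ModuleCat.{v} k) {p q r : P} (h : p ≤ q) (h' : q ≤ r) :
    LinearMap.range (transition V (h.trans h')) ≤ LinearMap.range (transition V h') := by
  rintro _ ⟨x, rfl⟩
  exact ⟨transition V h x, transition_transition V h h' x⟩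

lemma isChain_ker_transition (V : P ⥤ ModuleCat.{v} k) (p₀ : P) {S : Set P}
    (hS : IsChain (· ≤ ·) S) :
    IsChain (· ≤ ·) {N | ∃ p ∈ S, ∃ h : p₀ ≤ p, N = LinearMap.ker (transition V h)} := by
  rintro _ ⟨p, hp, h, rfl⟩ _ ⟨q, hq, h', rfl⟩ -
  rcases hS.total hp hq with hpq | hpq
  · exact .inl (ker_transition_mono V h hpq)
  · exact .inr (ker_transition_mono V h' hpq)

lemma isChain_range_transition (V : P ⥤ ModuleCat.{v} k) (p₀ : P) {S : Set P}
    (hS : IsChain (· ≤ ·) S) :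
    IsChain (· ≤ ·) {N | ∃ p ∈ S, ∃ h : p ≤ p₀, N = LinearMap.range (transition V h)} := by
  rintro _ ⟨p, hp, h, rfl⟩ _ ⟨q, hq, h', rfl⟩ -
  rcases hS.total hp hq with hpq | hpq
  · exact .inl (range_transition_mono V hpq h')
  · exact .inr (range_transition_mono V hpq h)

end FrameExistence

/-! ### The order of the bipath poset and its two maximal chains -/

namespace Bipath

@[simp] lemma negInf_le (x : Bipath) : negInf ≤ x := .inl rfl

@[simp] lemma le_posInf (x : Bipath) : x ≤ posInf := .inr (.inl rfl)

@[simp] lemma le_negInf_iff {x : Bipath} : x ≤ negInf ↔ x = negInf := by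
  simp [le_def]

@[simp] lemma posInf_le_iff {x : Bipath} : posInf ≤ x ↔ x = posInf := by
  simp [le_def]

@[simp] lemma pt_le_pt_iff {i j : Fin 2} {r s : ℝ} : pt i r ≤ pt j s ↔ i = j ∧ r ≤ s := by
  simp only [le_def, reduceCtorEq, false_or, pt.injEq]
  constructor
  · rintro ⟨_, _, _, ⟨rfl, rfl⟩, ⟨rfl, rfl⟩, h⟩
    exact ⟨rfl, h⟩
  · rintro ⟨rfl, h⟩
    exact ⟨_, _, _, ⟨rfl, rfl⟩, ⟨rfl, rfl⟩, h⟩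

/-- The `i`-th path of the bipath poset. -/
def path (i : Fin 2) : Set Bipath := {p | p = negInf ∨ p = posInf ∨ ∃ r, p = pt i r}

lemma isChain_path (i : Fin 2) : IsChain (· ≤ ·) (path i) := by
  rintro _ (rfl | rfl | ⟨r, rfl⟩) _ (rfl | rfl | ⟨s, rfl⟩) -
  all_goals simp [le_total]

@[simp] lemma pt_mem_path (i : Fin 2) (r : ℝ) : pt i r ∈ path i := .inr (.inr ⟨r, rfl⟩)
@[simp] lemma negInf_mem_path (i : Fin 2) : negInf ∈ path i := .inl rfl
@[simp] lemma posInf_mem_path (i : Fin 2) : posInf ∈ path i := .inr (.inl rfl)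

lemma mem_path_zero_or_one (p : Bipath) : p ∈ path 0 ∨ p ∈ path 1 := by
  cases p with
  | negInf => simp
  | posInf => simp
  | pt i r => fin_cases i <;> simp

end Bipath

/-! ### Interval summands over the bipath poset -/

section BipathFrame

universe v

variable {k : Type u} [Field k] (V : Bipath ⥤ ModuleCat.{v} k)
  [∀ p, Module.Finite k (V.obj p)]

open Bipath

/-- Every point lies above -∞, so only kernels matter, and these form one chain for each path. -/
lemma exists_frame_of_nontrivial_negInf [Nontrivial (V.obj .negInf)] :
    ∃ I, Nonempty (Frame V I) := by
  classical
  obtain ⟨x, θ, hθx, h0, h1⟩ := exists_vector_dual_of_isChain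
    (isChain_ker_transition V .negInf (isChain_path 0))
    (isChain_ker_transition V .negInf (isChain_path 1))
  have hker : ∀ p (h : Bipath.negInf ≤ p),
      transition V h x = 0 ∨ LinearMap.ker (transition V h) ≤ LinearMap.ker θ := by
    intro p h
    rcases mem_path_zero_or_one p with hp | hp
    · exact h0 _ ⟨p, hp, h, rfl⟩
    · exact h1 _ ⟨p, hp, h, rfl⟩
  have hη : ∃ η : ∀ p, Module.Dual k (V.obj p), η .negInf = θ ∧
      ∀ p q (h : Bipath.negInf ≤ p) (h' : p ≤ q), transition V (h.trans h') x ≠ 0 →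
      ∀ z, η q (transition V h' z) = η p z := by
    -- If `x` dies at +∞, the two paths share only -∞ among the points where `x` survives, so `θ`
    -- can be extended along each path separately. If it survives at +∞, the extensions have to
    -- agree there, which holds because the whole poset is directed.
    by_cases hinf : transition V (negInf_le .posInf) x = 0
    · have : ∀ i : Fin 2, ∃ η : ∀ p, Module.Dual k (V.obj p), η .negInf = θ ∧
          ∀ p ∈ {p | p ∈ path i ∧ transition V (negInf_le p) x ≠ 0},
          ∀ q ∈ {p | p ∈ path i ∧ transition V (negInf_le p) x ≠ 0},
          ∀ (h : p ≤ q) z, η q (transition V h z) = η p z := by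
        intro i
        refine exists_compatible_duals_on V
          (IsChain.directedOn ((isChain_path i).mono fun p hp => hp.1)) ?_ θ ?_
        · refine ⟨by simp, ?_⟩
          rintro h
          rw [transition_self] at h
          simp [h] at hθx
        · exact fun p hp h => (hker p h).resolve_left hp.2
      choose η hη0 hη using this
      refine ⟨fun p => match p with
        | .negInf => θ
        | .posInf => 0
        | .pt i r => η i (.pt i r), rfl, ?_⟩
      intro p q h h' hq z
      have hp : transition V h x ≠ 0 := by
        intro h0
        rw [← transition_transition V h h', h0, map_zero] at hq
        exact hq rfl
      rcases q with _ | _ | ⟨i, s⟩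
      · rw [le_negInf_iff] at h'
        subst h'
        simp
      · exact absurd hinf hq
      · rcases p with _ | _ | ⟨j, r⟩
        · rw [← hη0 i]
          exact hη i _ ⟨by simp, hp⟩ _ ⟨by simp, hq⟩ _ _
        · simp at h'
        · obtain ⟨rfl, -⟩ := pt_le_pt_iff.1 h'
          exact hη j _ ⟨by simp, hp⟩ _ ⟨by simp, hq⟩ _ _
    · obtain ⟨η, hη0, hη⟩ := exists_compatible_duals_on V (D := Set.univ) (p₀ := .negInf)
        (fun p _ q _ => ⟨.posInf, trivial, le_posInf p, le_posInf q⟩) trivial θ (fun p _ h =>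
          (ker_transition_mono V h (le_posInf p)).trans
            ((hker .posInf (negInf_le _)).resolve_left hinf))
      exact ⟨η, hη0, fun p q h h' _ z => hη p trivial q trivial h' z⟩
  obtain ⟨η, hη0, hη⟩ := hη
  refine exists_frame V .negInf x θ hθx (by simp) hker ?_
    (Function.update 0 .negInf x) (by simp) ?_ η hη0 hη
  · intro p h
    rw [le_negInf_iff] at h
    subst h
    exact .inl ⟨x, by simp⟩
  · intro p q h h' _
    rw [le_negInf_iff] at h'
    subst h'
    rw [le_negInf_iff] at h
    subst h
    simp

/-- This is dual to the case of -∞, with images along the two paths. As the space at -∞ is zero, `x`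
does not lift to it, and the lifts along the two paths need not be reconciled there. -/
lemma exists_frame_of_nontrivial_posInf [Subsingleton (V.obj .negInf)]
    [Nontrivial (V.obj .posInf)] : ∃ I, Nonempty (Frame V I) := by
  classical
  obtain ⟨x, θ, hθx, h0, h1⟩ := exists_vector_dual_of_isChain
    (isChain_range_transition V .posInf (isChain_path 0))
    (isChain_range_transition V .posInf (isChain_path 1))
  have hx : x ≠ 0 := by rintro rfl; simp at hθx
  have hrange : ∀ p (h : p ≤ Bipath.posInf), x ∈ LinearMap.range (transition V h) ∨
      LinearMap.range (transition V h) ≤ LinearMap.ker θ := by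
    intro p h
    rcases mem_path_zero_or_one p with hp | hp
    · exact h0 _ ⟨p, hp, h, rfl⟩
    · exact h1 _ ⟨p, hp, h, rfl⟩
  have hneg : x ∉ LinearMap.range (transition V (negInf_le .posInf)) := by
    rintro ⟨z, hz⟩
    rw [Subsingleton.elim z 0, map_zero] at hz
    exact hx hz.symm
  have : ∀ i : Fin 2, ∃ y : ∀ p, V.obj p, y .posInf = x ∧
      ∀ p ∈ {p | p ∈ path i ∧ x ∈ LinearMap.range (transition V (le_posInf p))},
      ∀ q ∈ {p | p ∈ path i ∧ x ∈ LinearMap.range (transition V (le_posInf p))},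
      ∀ h : p ≤ q, transition V h (y p) = y q := by
    intro i
    refine exists_compatible_vectors_on V
      (IsChain.directedOn (((isChain_path i).mono fun p hp => hp.1).symm)) ?_ x ?_
    · exact ⟨by simp, x, by simp⟩
    · exact fun p hp h => hp.2
  choose y hy0 hy using this
  refine exists_frame V .posInf x θ hθx (by simp) ?_ hrange
    (fun p => match p with
        | .negInf => 0
        | .posInf => x
        | .pt i r => y i (.pt i r)) rfl ?_ (Function.update 0 .posInf θ) (by simp) ?_
  · intro p h
    rw [posInf_le_iff] at h
    subst h
    right
    intro z hz
    rw [LinearMap.mem_ker, transition_self] at hz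
    simp [hz]
  · intro p q h h' hp
    have hq := range_transition_mono V h h' hp
    rcases p with _ | _ | ⟨i, s⟩
    · exact absurd hp hneg
    · rw [posInf_le_iff] at h
      subst h
      simp
    · rcases q with _ | _ | ⟨j, r⟩
      · simp at h
      · rw [← hy0 i]
        exact hy i _ ⟨by simp, hp⟩ _ ⟨by simp, hq⟩ _
      · obtain ⟨rfl, -⟩ := pt_le_pt_iff.1 h
        exact hy i _ ⟨by simp, hp⟩ _ ⟨by simp, hq⟩ _
  · intro p q h h' _
    rw [posInf_le_iff] at h
    subst h
    rw [posInf_le_iff] at h'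
    subst h'
    simp

/-- With zero spaces at ±∞ the two lines do not interact. On one line the kernels form one chain and
the images another. -/
lemma exists_frame_of_nontrivial_pt [Subsingleton (V.obj .negInf)]
    [Subsingleton (V.obj .posInf)] (i : Fin 2) (r : ℝ) [Nontrivial (V.obj (.pt i r))] :
    ∃ I, Nonempty (Frame V I) := by
  classical
  obtain ⟨x, θ, hθx, h0, h1⟩ := exists_vector_dual_of_isChain
    (isChain_ker_transition V (.pt i r) (isChain_path i))
    (isChain_range_transition V (.pt i r) (isChain_path i))
  have hx : x ≠ 0 := by rintro rfl; simp at hθx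
  have hup : ∀ p, Bipath.pt i r ≤ p → p ∈ path i := by
    rintro (_ | _ | ⟨j, s⟩) h
    · simp
    · simp
    · obtain ⟨rfl, -⟩ := pt_le_pt_iff.1 h
      simp
  have hdown : ∀ p, p ≤ Bipath.pt i r → p ∈ path i := by
    rintro (_ | _ | ⟨j, s⟩) h
    · simp
    · simp
    · obtain ⟨rfl, -⟩ := pt_le_pt_iff.1 h
      simp
  have hne : ∀ p, Nontrivial (V.obj p) → ∃ j s, p = .pt j s := by
    rintro (_ | _ | ⟨j, s⟩) h
    · exact absurd h (not_nontrivial_iff_subsingleton.2 inferInstance)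
    · exact absurd h (not_nontrivial_iff_subsingleton.2 inferInstance)
    · exact ⟨j, s, rfl⟩
  obtain ⟨y, hy0, hy⟩ := exists_compatible_vectors_on V (p₀ := .pt i r)
    (D := {p | ∃ h : p ≤ .pt i r, x ∈ LinearMap.range (transition V h)})
    (IsChain.directedOn (((isChain_path i).mono fun p hp => hdown p hp.1).symm))
    ⟨le_rfl, x, by simp⟩ x (fun p hp h => hp.2)
  obtain ⟨η, hη0, hη⟩ := exists_compatible_duals_on V (p₀ := .pt i r)
    (D := {p | ∃ h : .pt i r ≤ p, transition V h x ≠ 0})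
    (IsChain.directedOn (((isChain_path i).mono fun p hp => hup p hp.1)))
    ⟨le_rfl, by simpa using hx⟩ θ
    (fun p hp h => (h0 _ ⟨p, hup p h, h, rfl⟩).resolve_left hp.2)
  refine exists_frame V (.pt i r) x θ hθx ?_ (fun p h => h0 _ ⟨p, hup p h, h, rfl⟩)
    (fun p h => h1 _ ⟨p, hdown p h, h, rfl⟩) y hy0 ?_ η hη0 ?_
  · intro p q h hp hq
    obtain ⟨j, s, rfl⟩ := hne p hp
    obtain ⟨j', s', rfl⟩ := hne q hq
    obtain ⟨rfl, -⟩ := pt_le_pt_iff.1 h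
    by_cases hj : i = j
    · subst hj
      simp [le_total]
    · simp [hj, Ne.symm hj]
  · intro p q h h' hp
    exact hy p ⟨h.trans h', hp⟩ q ⟨h', range_transition_mono V h h' hp⟩ h
  · intro p q h h' hq
    refine hη p ⟨h, fun hp => hq ?_⟩ q ⟨h.trans h', hq⟩ h'
    rw [← transition_transition V h h', hp, map_zero]

/-- Every nonzero pointwise finite-dimensional persistence module over the bipath poset has an
interval module as a direct summand. -/
theorem exists_frame_of_nontrivial (p : Bipath) [Nontrivial (V.obj p)] :
    ∃ I, Nonempty (Frame V I) := by
  rcases subsingleton_or_nontrivial (V.obj .negInf) with h | h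
  · rcases subsingleton_or_nontrivial (V.obj .posInf) with h' | h'
    · rcases p with _ | _ | ⟨i, r⟩
      · exact exists_frame_of_nontrivial_negInf V
      · exact exists_frame_of_nontrivial_posInf V
      · exact exists_frame_of_nontrivial_pt V i r
    · exact exists_frame_of_nontrivial_posInf V
  · exact exists_frame_of_nontrivial_negInf V

end BipathFrame

/-! ### Biorthogonal families of interval summands and their exhaustion by Zorn's lemma -/

section FrameSystem

universe v

variable {k : Type u} [Field k] {P : Type*} [PartialOrder P]

/-- Families of interval summands which are independent, in the strong sense that the projection to
each of them vanishes on the others. -/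
structure FrameSystem (V : P ⥤ ModuleCat.{v} k) {ι : Type*} (I : ι → PosetInterval P) where
  frame : ∀ a, Frame V (I a)
  fn_vec_of_ne : ∀ a b, a ≠ b → ∀ p, (frame b).fn p ((frame a).vec p) = 0

namespace FrameSystem

variable {V : P ⥤ ModuleCat.{v} k} {ι : Type*} {I : ι → PosetInterval P} (F : FrameSystem V I)

/-- A frame system is spanning if the vectors of its members span all spaces. -/
def Spanning : Prop := ∀ p, Submodule.span k (Set.range fun a => (F.frame a).vec p) = ⊤

/-- Biorthogonality makes the vectors of the intervals through `p` linearly independent. This local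
finiteness makes the sum in `residual` meaningful. -/
lemma finite_mem (F : FrameSystem V I) (p : P) [Module.Finite k (V.obj p)] :
    {a | p ∈ (I a).carrier}.Finite := by
  have : LinearIndependent k (fun a : {a | p ∈ (I a).carrier} => (F.frame a).vec p) :=
    LinearIndependent.of_pairwise_dual_eq_zero_one _ (fun a => (F.frame a).fn p)
      (fun a b hab => F.fn_vec_of_ne _ _ (fun h => hab (Subtype.ext h).symm) p)
      (fun a => (F.frame a).fn_vec p a.2)
  exact Set.finite_coe_iff.1 this.finite_of_isNoetherian

/-- The common kernel of the functionals of a frame system. -/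
def commonKer (p : P) : Submodule k (V.obj p) := ⨅ a, LinearMap.ker ((F.frame a).fn p)

lemma mem_commonKer {p : P} {x : V.obj p} :
    x ∈ F.commonKer p ↔ ∀ a, (F.frame a).fn p x = 0 := by
  simp [commonKer]

lemma transition_mem_commonKer {p q : P} (h : p ≤ q) (x : V.obj p) (hx : x ∈ F.commonKer p) :
    transition V h x ∈ F.commonKer q := by
  rw [mem_commonKer] at hx ⊢
  intro a
  by_cases hq : q ∈ (I a).carrier
  · rw [(F.frame a).fn_transition p q h hq, hx]
  · simp [(F.frame a).fn_eq_zero q hq]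

variable [∀ p, Module.Finite k (V.obj p)]

/-- The projection onto the common kernel of the functionals of a frame system along the span of
its vectors. -/
def residual (p : P) : V.obj p →ₗ[k] V.obj p :=
  LinearMap.id - ∑ a ∈ (F.finite_mem p).toFinset, ((F.frame a).fn p).smulRight ((F.frame a).vec p)

lemma residual_apply (p : P) (T : Finset ι) (hT : ∀ a, p ∈ (I a).carrier → a ∈ T) (x : V.obj p) :
    F.residual p x = x - ∑ a ∈ T, (F.frame a).fn p x • (F.frame a).vec p := by
  simp only [residual, LinearMap.sub_apply, LinearMap.id_apply, LinearMap.sum_apply,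
    LinearMap.smulRight_apply]
  congr 1
  refine Finset.sum_subset (fun a ha => hT a (by simpa using ha)) fun a _ ha => ?_
  rw [(F.frame a).vec_eq_zero p (by simpa using ha), smul_zero]

lemma fn_residual (b : ι) (p : P) (x : V.obj p) : (F.frame b).fn p (F.residual p x) = 0 := by
  by_cases hb : p ∈ (I b).carrier
  · rw [F.residual_apply p (F.finite_mem p).toFinset (by simp), map_sub, map_sum,
      Finset.sum_eq_single b]
    · simp [(F.frame b).fn_vec p hb]
    · intro a _ hab
      simp [F.fn_vec_of_ne a b hab p]
    · intro h
      exact absurd hb (by simpa using h)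
  · simp [(F.frame b).fn_eq_zero p hb]

lemma residual_vec (b : ι) (p : P) : F.residual p ((F.frame b).vec p) = 0 := by
  by_cases hb : p ∈ (I b).carrier
  · rw [F.residual_apply p (F.finite_mem p).toFinset (by simp), Finset.sum_eq_single b]
    · simp [(F.frame b).fn_vec p hb]
    · intro a _ hab
      simp [F.fn_vec_of_ne b a hab.symm p]
    · intro h
      exact absurd hb (by simpa using h)
  · simp [(F.frame b).vec_eq_zero p hb]

lemma residual_of_forall_fn_eq_zero (p : P) (x : V.obj p) (hx : ∀ a, (F.frame a).fn p x = 0) :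
    F.residual p x = x := by
  rw [F.residual_apply p (F.finite_mem p).toFinset (by simp)]
  simp [hx]

lemma transition_residual {p q : P} (h : p ≤ q) (x : V.obj p) :
    transition V h (F.residual p x) = F.residual q (transition V h x) := by
  classical
  set T := (F.finite_mem p).toFinset ∪ (F.finite_mem q).toFinset with hT
  rw [F.residual_apply p T fun a ha => by simp [hT, show p ∈ (I a).carrier from ha],
    F.residual_apply q T fun a ha => by simp [hT, show q ∈ (I a).carrier from ha],
    map_sub, map_sum]
  congr 1
  refine Finset.sum_congr rfl fun a _ => ?_
  rw [map_smul]
  by_cases hq : q ∈ (I a).carrier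
  · rw [(F.frame a).fn_transition p q h hq]
    by_cases hp : p ∈ (I a).carrier
    · rw [(F.frame a).transition_vec p q h hp]
    · simp [(F.frame a).fn_eq_zero p hp]
  · by_cases hp : p ∈ (I a).carrier
    · rw [(F.frame a).transition_vec p q h hp, (F.frame a).vec_eq_zero q hq]
      simp
    · rw [(F.frame a).vec_eq_zero p hp, (F.frame a).vec_eq_zero q hq]
      simp

lemma spanning_of_residual_eq_zero (h : ∀ p x, F.residual p x = 0) : F.Spanning := by
  intro p
  rw [eq_top_iff]
  intro x _
  have hx := h p x
  rw [F.residual_apply p (F.finite_mem p).toFinset (by simp), sub_eq_zero] at hx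
  rw [hx]
  exact Submodule.sum_mem _ fun a _ => Submodule.smul_mem _ _ (Submodule.subset_span ⟨a, rfl⟩)

lemma Spanning.residual_eq_zero {F : FrameSystem V I} (hF : F.Spanning) (p : P) (x : V.obj p) :
    F.residual p x = 0 := by
  have : F.residual p = 0 := by
    apply LinearMap.ext_on (hF p)
    rintro _ ⟨a, rfl⟩
    simp [F.residual_vec a p]
  simp [this]

lemma Spanning.eq_sum {F : FrameSystem V I} (hF : F.Spanning) (p : P) (T : Finset ι)
    (hT : ∀ a, p ∈ (I a).carrier → a ∈ T) (x : V.obj p) :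
    x = ∑ a ∈ T, (F.frame a).fn p x • (F.frame a).vec p := by
  rw [← sub_eq_zero, ← F.residual_apply p T hT, hF.residual_eq_zero]

end FrameSystem

/-- The persistence submodule of `V` with spaces `N p`. -/
def subobject (V : P ⥤ ModuleCat.{v} k) (N : ∀ p, Submodule k (V.obj p))
    (hN : ∀ p q (h : p ≤ q), ∀ x ∈ N p, transition V h x ∈ N q) : P ⥤ ModuleCat.{v} k where
  obj p := ModuleCat.of k (N p)
  map {p q} h := ModuleCat.ofHom ((transition V (leOfHom h)).restrict (hN p q (leOfHom h)))
  map_id p := by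
    refine ModuleCat.hom_ext (LinearMap.ext fun (x : N p) => ?_)
    exact Subtype.ext (transition_self V le_rfl x.1)
  map_comp {p q r} h h' := by
    refine ModuleCat.hom_ext (LinearMap.ext fun (x : N p) => ?_)
    exact Subtype.ext (transition_transition V (leOfHom h) (leOfHom h') x.1).symm

/-- A frame of the common kernel of a frame system, as a frame of the ambient module. -/
def FrameSystem.liftFrame {V : P ⥤ ModuleCat.{v} k} {ι : Type*} {I : ι → PosetInterval P}
    (F : FrameSystem V I) [∀ p, Module.Finite k (V.obj p)] {J : PosetInterval P}
    (G : Frame (subobject V F.commonKer fun _ _ h => F.transition_mem_commonKer h) J) :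
    Frame V J where
  vec p := (show F.commonKer p from G.vec p : V.obj p)
  fn p := (show Module.Dual k (F.commonKer p) from G.fn p) ∘ₗ
    (F.residual p).codRestrict (F.commonKer p)
      (fun x => F.mem_commonKer.2 fun a => F.fn_residual a p x)
  vec_eq_zero p hp := congrArg Subtype.val (G.vec_eq_zero p hp)
  fn_eq_zero p hp := by
    ext x
    exact LinearMap.congr_fun (G.fn_eq_zero p hp) _
  transition_vec p q h hp := congrArg Subtype.val (G.transition_vec p q h hp)
  fn_transition p q h hq x := by
    refine Eq.trans ?_ (G.fn_transition p q h hq _)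
    exact congrArg (G.fn q) (Subtype.ext (F.transition_residual h x).symm)
  fn_vec p hp := by
    refine Eq.trans ?_ (G.fn_vec p hp)
    refine congrArg (G.fn p) (Subtype.ext ?_)
    exact F.residual_of_forall_fn_eq_zero p _ (F.mem_commonKer.1 (Subtype.prop _))

/-- If all nonzero pointwise finite-dimensional modules have interval summands, then they are direct
sums of interval modules. -/
theorem exists_spanning_frameSystem
    (hex : ∀ W : P ⥤ ModuleCat.{v} k, (∀ p, Module.Finite k (W.obj p)) →
      ∀ p, Nontrivial (W.obj p) → ∃ I, Nonempty (Frame W I))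
    (V : P ⥤ ModuleCat.{v} k) [∀ p, Module.Finite k (V.obj p)] :
    ∃ (S : Set (Σ I, Frame V I)) (F : FrameSystem V fun s : S => s.1.1), F.Spanning := by
  -- Maximality forces the residual to vanish: otherwise the common kernel has an interval summand.
  -- Its vectors are killed by the old functionals, and precomposing its functionals with the
  -- residual makes them kill the old vectors, so it could be added.
  obtain ⟨S, hS⟩ := zorn_subset
    {S : Set (Σ I, Frame V I) | ∀ s ∈ S, ∀ t ∈ S, s ≠ t → ∀ p, t.2.fn p (s.2.vec p) = 0} (by
      intro c hc hchain
      refine ⟨⋃₀ c, ?_, fun s hs => Set.subset_sUnion_of_mem hs⟩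
      rintro s ⟨A, hA, hsA⟩ t ⟨B, hB, htB⟩ hst
      rcases hchain.total hA hB with h | h
      · exact hc hB s (h hsA) t htB hst
      · exact hc hA s hsA t (h htB) hst)
  let F : FrameSystem V fun s : S => s.1.1 :=
    ⟨fun s => s.1.2, fun a b hab => hS.prop a a.2 b b.2 fun h => hab (Subtype.ext h)⟩
  refine ⟨S, F, F.spanning_of_residual_eq_zero fun p x => ?_⟩
  by_contra hx
  have hmem : F.residual p x ∈ F.commonKer p := F.mem_commonKer.2 fun a => F.fn_residual a p x
  obtain ⟨J, ⟨G⟩⟩ := hex (subobject V F.commonKer fun _ _ h => F.transition_mem_commonKer h)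
    (fun p => inferInstanceAs (Module.Finite k (F.commonKer p))) p
    ⟨⟨_, hmem⟩, 0, fun h => hx (congrArg Subtype.val h)⟩
  have hker : ∀ s ∈ S, ∀ p, s.2.fn p ((F.liftFrame G).vec p) = 0 := fun s hs p =>
    F.mem_commonKer.1 (Subtype.prop (show F.commonKer p from G.vec p)) ⟨s, hs⟩
  have hfn : ∀ s ∈ S, ∀ p, (F.liftFrame G).fn p (s.2.vec p) = 0 := fun s hs p => by
    have h0 : F.residual p (s.2.vec p) = 0 := F.residual_vec ⟨s, hs⟩ p
    exact (congrArg (G.fn p) (Subtype.ext h0)).trans (map_zero (G.fn p))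
  have hins : insert ⟨J, F.liftFrame G⟩ S ∈ {S : Set (Σ I, Frame V I) |
      ∀ s ∈ S, ∀ t ∈ S, s ≠ t → ∀ p, t.2.fn p (s.2.vec p) = 0} := by
    rintro s (rfl | hs) t (rfl | ht) hst
    · exact absurd rfl hst
    · exact hker t ht
    · exact hfn s hs
    · exact hS.prop s hs t ht hst
  have hGS : (⟨J, F.liftFrame G⟩ : Σ I, Frame V I) ∈ S :=
    hS.le_of_ge hins (Set.subset_insert _ _) (Set.mem_insert _ _)
  -- The new frame would already belong to `S`, so its own functional would kill its own vector,
  -- where it takes the value 1.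
  obtain ⟨q, hq⟩ := J.nonempty
  have h1 := hfn _ hGS q
  rw [(F.liftFrame G).fn_vec q hq] at h1
  exact one_ne_zero h1

end FrameSystem

/-! ### Persistence diagrams and spanning frame systems -/

section Diagram

variable {k : Type u} [Field k] {P : Type} [PartialOrder P]

open Classical in
/-- The generator of the interval module of `I` at the points of `I`. -/
def intervalGen (k : Type u) [Field k] (I : PosetInterval P) (p : P) :
    intervalFiber.{u, w} k I p :=
  if h : p ∈ I.carrier then ⟨ULift.up 1, (intervalFiber_of_mem k I h).ge trivial⟩ else 0

lemma intervalGen_of_mem {I : PosetInterval P} {p : P} (h : p ∈ I.carrier) :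
    (intervalGen.{u, w} k I p : ULift.{w} k) = ULift.up 1 := by
  simp [intervalGen, h]

lemma intervalGen_of_notMem {I : PosetInterval P} {p : P} (h : p ∉ I.carrier) :
    intervalGen.{u, w} k I p = 0 := by
  simp [intervalGen, h]

/-- The coordinate on the interval module of `I`. -/
def intervalCoord (k : Type u) [Field k] (I : PosetInterval P) (p : P) :
    Module.Dual k (intervalFiber.{u, w} k I p) :=
  ULift.moduleEquiv.toLinearMap ∘ₗ (intervalFiber.{u, w} k I p).subtype

lemma intervalFiber_eq_zero {I : PosetInterval P} {p : P} (h : p ∉ I.carrier)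
    (c : intervalFiber.{u, w} k I p) : c = 0 :=
  Subtype.ext ((Submodule.mem_bot k).1 ((intervalFiber_of_notMem.{u, w} k I h).le c.2))

lemma intervalCoord_gen {I : PosetInterval P} {p : P} (h : p ∈ I.carrier) :
    intervalCoord.{u, w} k I p (intervalGen k I p) = 1 := by
  simp [intervalCoord, intervalGen_of_mem h]

lemma intervalCoord_smul_gen (I : PosetInterval P) (p : P) (c : intervalFiber.{u, w} k I p) :
    intervalCoord k I p c • intervalGen k I p = c := by
  by_cases h : p ∈ I.carrier
  · ext
    simp [intervalCoord, intervalGen_of_mem h]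
  · rw [intervalFiber_eq_zero h c, map_zero, zero_smul]

lemma intervalMap_gen {I : PosetInterval P} {p q : P} (h : p ∈ I.carrier) :
    intervalMap.{u, w} k I p q (intervalGen k I p) = intervalGen k I q := by
  by_cases hq : q ∈ I.carrier
  · ext
    simp [intervalMap, h, hq, intervalGen_of_mem]
  · simp [intervalMap, hq, intervalGen_of_notMem]

lemma intervalCoord_map {I : PosetInterval P} {p q : P} (h : q ∈ I.carrier)
    (c : intervalFiber.{u, w} k I p) :
    intervalCoord k I q (intervalMap.{u, w} k I p q c) = intervalCoord k I p c := by
  by_cases hp : p ∈ I.carrier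
  · simp [intervalCoord, intervalMap, h, hp]
  · rw [intervalFiber_eq_zero hp c]
    simp

lemma transition_naturality {V W : P ⥤ ModuleCat.{max u w} k} (φ : V ⟶ W) {p q : P} (h : p ≤ q)
    (x : V.obj p) : (φ.app q).hom (transition V h x) = transition W h ((φ.app p).hom x) :=
  LinearMap.congr_fun (congrArg ModuleCat.Hom.hom (φ.naturality (homOfLE h))) x

variable {V : P ⥤ ModuleCat.{max u w} k}

/-- The inclusion of the interval module given by a frame. -/
def Frame.inclusion {I : PosetInterval P} (F : Frame V I) : intervalModule.{u, w} k I ⟶ V where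
  app p := ModuleCat.ofHom ((intervalCoord k I p).smulRight (F.vec p))
  naturality p q h := by
    refine ModuleCat.hom_ext (LinearMap.ext fun (c : intervalFiber k I p) => ?_)
    change intervalCoord k I q (intervalMap k I p q c) • F.vec q =
      transition V (leOfHom h) (intervalCoord k I p c • F.vec p)
    rw [map_smul]
    by_cases hp : p ∈ I.carrier
    · rw [F.transition_vec p q _ hp]
      by_cases hq : q ∈ I.carrier
      · rw [intervalCoord_map hq]
      · rw [F.vec_eq_zero q hq, smul_zero, smul_zero]
    · rw [intervalFiber_eq_zero hp c]
      simp

lemma Frame.inclusion_gen {I : PosetInterval P} (F : Frame V I) (p : P) :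
    (F.inclusion.app p).hom (intervalGen k I p) = F.vec p := by
  change intervalCoord k I p (intervalGen k I p) • F.vec p = F.vec p
  by_cases hp : p ∈ I.carrier
  · rw [intervalCoord_gen hp, one_smul]
  · rw [F.vec_eq_zero p hp, smul_zero]

/-- The frame of an interval module which is a retract. -/
def Frame.ofRetract {I : PosetInterval P} (i : intervalModule.{u, w} k I ⟶ V)
    (r : V ⟶ intervalModule.{u, w} k I) (h : i ≫ r = 𝟙 _) : Frame V I where
  vec p := (i.app p).hom (intervalGen k I p)
  fn p := intervalCoord k I p ∘ₗ (r.app p).hom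
  vec_eq_zero p hp := by
    rw [intervalGen_of_notMem hp]
    exact map_zero (i.app p).hom
  fn_eq_zero p hp := by
    ext x
    exact (congrArg (intervalCoord k I p) (intervalFiber_eq_zero hp _)).trans
      (map_zero (intervalCoord.{u, w} k I p))
  transition_vec p q hpq hp := by
    refine (transition_naturality i hpq (intervalGen k I p)).symm.trans ?_
    exact congrArg (i.app q).hom (intervalMap_gen hp)
  fn_transition p q hpq hq x := by
    refine (congrArg (intervalCoord k I q) (transition_naturality r hpq x)).trans ?_
    exact intervalCoord_map hq _
  fn_vec p hp := by
    refine Eq.trans (congrArg (intervalCoord k I p) ?_) (intervalCoord_gen hp)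
    exact LinearMap.congr_fun (congrArg ModuleCat.Hom.hom (NatTrans.congr_app h p)) _

open Classical in
/-- The frame system of a direct sum decomposition into interval modules. -/
def FrameSystem.ofIso {ι : Type} {I : ι → PosetInterval P}
    (e : V ≅ ∐ fun a => intervalModule.{u, w} k (I a)) : FrameSystem V I where
  frame a := Frame.ofRetract (Sigma.ι (fun a => intervalModule.{u, w} k (I a)) a ≫ e.inv)
    (e.hom ≫ Sigma.π (fun a => intervalModule.{u, w} k (I a)) a) (by simp)
  fn_vec_of_ne a b hab p := by
    have h : (Sigma.ι (fun a => intervalModule.{u, w} k (I a)) a ≫ e.inv) ≫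
      (e.hom ≫ Sigma.π (fun a => intervalModule.{u, w} k (I a)) b) = 0 := by
      simp [Sigma.ι_π_of_ne _ hab]
    refine Eq.trans (congrArg (intervalCoord k (I b) p) ?_) (map_zero _)
    exact LinearMap.congr_fun (congrArg ModuleCat.Hom.hom (NatTrans.congr_app h p)) _

lemma sigma_app_hom_ext {ι : Type} (f : ι → P ⥤ ModuleCat.{max u w} k) (p : P)
    {M : ModuleCat.{max u w} k} (φ ψ : (∐ f).obj p ⟶ M)
    (h : ∀ a, (Sigma.ι f a).app p ≫ φ = (Sigma.ι f a).app p ≫ ψ) : φ = ψ := by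
  refine (isColimitOfPreserves ((evaluation P (ModuleCat.{max u w} k)).obj p)
    (colimit.isColimit (Discrete.functor f))).hom_ext ?_
  rintro ⟨a⟩
  exact h a

lemma app_eq_smul_app_gen {I : PosetInterval P} (i : intervalModule.{u, w} k I ⟶ V) (p : P)
    (c : intervalFiber.{u, w} k I p) :
    (i.app p).hom c = intervalCoord k I p c • (i.app p).hom (intervalGen k I p) := by
  let φ : intervalFiber.{u, w} k I p →ₗ[k] V.obj p := (i.app p).hom
  change φ c = intervalCoord k I p c • φ (intervalGen k I p)
  rw [← map_smul, intervalCoord_smul_gen]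

/-- The quotient map by the span vanishes on every summand, and coproducts of functors are computed
pointwise, so it is zero. -/
lemma FrameSystem.spanning_ofIso {ι : Type} {I : ι → PosetInterval P}
    (e : V ≅ ∐ fun a => intervalModule.{u, w} k (I a)) : (FrameSystem.ofIso e).Spanning := by
  intro p
  set T := Submodule.span k (Set.range fun a => ((FrameSystem.ofIso e).frame a).vec p) with hT
  have key : e.inv.app p ≫ ModuleCat.ofHom T.mkQ = 0 := by
    refine sigma_app_hom_ext _ p _ _ fun a =>
      ModuleCat.hom_ext (LinearMap.ext fun (c : intervalFiber k (I a) p) => ?_)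
    refine (Submodule.Quotient.mk_eq_zero T).2 ?_
    refine Eq.subst (motive := fun z => z ∈ T) (app_eq_smul_app_gen
      (Sigma.ι (fun a => intervalModule.{u, w} k (I a)) a ≫ e.inv) p c).symm ?_
    exact T.smul_mem _ (Submodule.subset_span ⟨a, rfl⟩)
  have hzero : ModuleCat.ofHom T.mkQ = 0 := by
    have : e.hom.app p ≫ e.inv.app p ≫ ModuleCat.ofHom T.mkQ = 0 := by rw [key, comp_zero]
    rwa [← Category.assoc, ← NatTrans.comp_app, e.hom_inv_id, NatTrans.id_app,
      Category.id_comp] at this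
  rw [eq_top_iff]
  intro x _
  rw [← Submodule.Quotient.mk_eq_zero, ← Submodule.mkQ_apply]
  exact LinearMap.congr_fun (congrArg ModuleCat.Hom.hom hzero) x

/-- A spanning frame system decomposes the module as a direct sum of interval modules. -/
lemma FrameSystem.Spanning.nonempty_iso {ι : Type} {I : ι → PosetInterval P}
    {F : FrameSystem V I} (hF : F.Spanning) :
    Nonempty (V ≅ ∐ fun a => intervalModule.{u, w} k (I a)) := by
  let f : ι → P ⥤ ModuleCat.{max u w} k := fun a => intervalModule.{u, w} k (I a)
  let φ : ∐ f ⟶ V := Sigma.desc fun a => (F.frame a).inclusion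
  have hι : ∀ a, Sigma.ι f a ≫ φ = (F.frame a).inclusion := fun a => by simp [φ]
  let G : FrameSystem (∐ f) I := FrameSystem.ofIso (Iso.refl _)
  have hG : G.Spanning := FrameSystem.spanning_ofIso (Iso.refl _)
  have hφ : ∀ a p, (φ.app p).hom ((G.frame a).vec p) = (F.frame a).vec p := by
    intro a p
    rw [← (F.frame a).inclusion_gen p, ← hι a]
    change (φ.app p).hom (((Sigma.ι f a ≫ 𝟙 _).app p).hom (intervalGen k (I a) p)) = _
    rw [Category.comp_id]
    rfl
  have hbij : ∀ p, Function.Bijective (φ.app p).hom := by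
    intro p
    constructor
    · rw [← LinearMap.ker_eq_bot, LinearMap.ker_eq_bot']
      intro x hx
      obtain ⟨c, rfl⟩ := Finsupp.mem_span_range_iff_exists_finsupp.1
        ((hG p).ge (Submodule.mem_top (x := x)))
      refine Finset.sum_eq_zero fun b hb => ?_
      by_cases hp : p ∈ (I b).carrier
      · have h1 := congrArg ((F.frame b).fn p) hx
        rw [map_finsuppSum, map_finsuppSum, map_zero, Finsupp.sum, Finset.sum_eq_single b] at h1
        · rw [map_smul, map_smul, hφ, (F.frame b).fn_vec p hp, smul_eq_mul, mul_one] at h1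
          simp [h1]
        · intro a _ hab
          rw [map_smul, map_smul, hφ, F.fn_vec_of_ne a b hab, smul_zero]
        · exact fun h => absurd hb h
      · simp [(G.frame b).vec_eq_zero p hp]
    · rw [← LinearMap.range_eq_top, eq_top_iff, ← hF p, Submodule.span_le]
      rintro _ ⟨a, rfl⟩
      exact ⟨_, hφ a p⟩
  have : ∀ p, IsIso (φ.app p) := fun p => (ConcreteCategory.isIso_iff_bijective _).2 (hbij p)
  have : IsIso φ := NatIso.isIso_of_isIso_app φ
  exact ⟨(asIso φ).symm⟩

/-- Multiplicities are finite because all copies of an interval pass through a common point.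
Reindexing by the resulting multiset also moves the index set to the required universe. -/
theorem FrameSystem.Spanning.exists_isPersistenceDiagram [∀ p, Module.Finite k (V.obj p)]
    {ι : Type*} {I : ι → PosetInterval P} {F : FrameSystem V I} (hF : F.Spanning) :
    ∃ A : IntervalMultiset P, IsPersistenceDiagram.{u, w} V A := by
  have hfin : ∀ J, Finite {a // I a = J} := by
    intro J
    obtain ⟨p, hp⟩ := J.nonempty
    exact ((F.finite_mem p).subset fun a (ha : I a = J) => by
      rw [Set.mem_ofPred_eq, ha]; exact hp).to_subtype
  let A : IntervalMultiset P := fun J => Nat.card {a // I a = J}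
  let σ : A.Elem ≃ ι := (Equiv.sigmaCongrRight fun J =>
    (Finite.equivFin {a // I a = J}).symm).trans (Equiv.sigmaFiberEquiv I)
  have hσ : (fun a : A.Elem => a.1) = I ∘ σ := by
    ext1 ⟨J, n⟩
    exact ((Finite.equivFin {a // I a = J}).symm n).2.symm
  let F' : FrameSystem V (I ∘ σ) :=
    ⟨fun a => F.frame (σ a), fun a b hab => F.fn_vec_of_ne _ _ (σ.injective.ne hab)⟩
  have hF' : F'.Spanning := by
    intro p
    rw [← hF p]
    congr 1
    exact σ.surjective.range_comp fun a => (F.frame a).vec p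
  refine ⟨A, ?_⟩
  have := hF'.nonempty_iso
  rwa [← hσ] at this

end Diagram

/-- Pointwise finite-dimensional persistence modules over the bipath poset have persistence
diagrams. -/
theorem exists_isPersistenceDiagram_bipath {k : Type u} [Field k]
    (V : Bipath ⥤ ModuleCat.{max u w} k) (hV : IsPFD.{u, w} V) :
    ∃ A, IsPersistenceDiagram.{u, w} V A := by
  have : ∀ p, Module.Finite k (V.obj p) := hV
  obtain ⟨S, F, hF⟩ := exists_spanning_frameSystem
    (fun W hW p hp => exists_frame_of_nontrivial W p) V
  exact hF.exists_isPersistenceDiagram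

/-! ### Matchings -/

section Matching

variable {α β : Type*}

/-- A relation which is a partial bijection, as a `PEquiv`. -/
lemma exists_pequiv_of_rel (Q : α → β → Prop) (hl : ∀ a b b', Q a b → Q a b' → b = b')
    (hr : ∀ a a' b, Q a b → Q a' b → a = a') :
    ∃ σ : α ≃. β, ∀ a b, σ a = some b ↔ Q a b := by
  classical
  have h1 : ∀ a b, (if h : ∃ b, Q a b then some h.choose else none) = some b ↔ Q a b := by
    intro a b
    split_ifs with h
    · rw [Option.some_inj]
      exact ⟨fun hb => hb ▸ h.choose_spec, fun hb => hl a _ _ h.choose_spec hb⟩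
    · simpa using fun hb => h ⟨b, hb⟩
  have h2 : ∀ a b, (if h : ∃ a, Q a b then some h.choose else none) = some a ↔ Q a b := by
    intro a b
    split_ifs with h
    · rw [Option.some_inj]
      exact ⟨fun hb => hb ▸ h.choose_spec, fun hb => hr _ _ b h.choose_spec hb⟩
    · simpa using fun hb => h ⟨a, hb⟩
  exact ⟨⟨fun a => if h : ∃ b, Q a b then some h.choose else none,
    fun b => if h : ∃ a, Q a b then some h.choose else none,
    fun a b => (h2 a b).trans (h1 a b).symm⟩, h1⟩

/-- The Mendelsohn–Dulmage theorem: if one matching covers `A` and another one covers `B`, then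
there is a matching which covers both. -/
theorem exists_pequiv_covering (R : α → β → Prop) (A : Set α) (B : Set β) (f : α → β) (g : β → α)
    (hf : Set.InjOn f A) (hg : Set.InjOn g B) (hfR : ∀ a ∈ A, R a (f a))
    (hgR : ∀ b ∈ B, R (g b) b) :
    ∃ σ : α ≃. β, (∀ a b, σ a = some b → R a b) ∧ (∀ a ∈ A, σ a ≠ none) ∧
      ∀ b ∈ B, σ.symm b ≠ none := by
  -- As in the Schröder–Bernstein theorem: on a fixed point `X` of this monotone operator match by
  -- `f`, and match the part of `B` outside `f '' X` by `g`.
  let Φ : Set α →o Set α := ⟨fun X => A \ (g '' (B \ (f '' X))), fun X Y h =>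
    Set.sdiff_subset_sdiff_right (Set.image_mono (Set.sdiff_subset_sdiff_right (Set.image_mono h)))⟩
  obtain ⟨X, hX⟩ : ∃ X, A \ (g '' (B \ (f '' X))) = X := ⟨OrderHom.lfp Φ, Φ.map_lfp⟩
  have hXA : X ⊆ A := hX ▸ Set.sdiff_subset
  have hXg : ∀ a ∈ X, ∀ b ∈ B, b ∉ f '' X → g b ≠ a := by
    intro a ha b hb hbX hba
    rw [← hX] at ha
    exact ha.2 ⟨b, ⟨hb, hbX⟩, hba⟩
  obtain ⟨σ, hσ⟩ := exists_pequiv_of_rel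
    (fun a b => (a ∈ X ∧ f a = b) ∨ (b ∈ B ∧ b ∉ f '' X ∧ g b = a)) (by
      rintro a b b' (⟨ha, rfl⟩ | ⟨hb, hbX, rfl⟩) (⟨ha', rfl⟩ | ⟨hb', hbX', hgb⟩)
      · rfl
      · exact absurd hgb (hXg a ha b' hb' hbX')
      · exact absurd rfl (hXg _ ha' b hb hbX)
      · exact (hg hb' hb hgb).symm) (by
      rintro a a' b (⟨ha, rfl⟩ | ⟨hb, hbX, rfl⟩) (⟨ha', hab⟩ | ⟨hb', hbX', hgb⟩)
      · exact (hf (hXA ha') (hXA ha) hab).symm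
      · exact absurd ⟨a, ha, rfl⟩ hbX'
      · exact absurd ⟨a', ha', hab⟩ hbX
      · exact hgb)
  refine ⟨σ, fun a b hab => ?_, fun a ha => ?_, fun b hb => ?_⟩
  · rcases (hσ a b).1 hab with ⟨ha, rfl⟩ | ⟨hb, -, rfl⟩
    · exact hfR a (hXA ha)
    · exact hgR b hb
  · by_cases haX : a ∈ X
    · rw [(hσ a (f a)).2 (.inl ⟨haX, rfl⟩)]
      exact Option.some_ne_none _
    · obtain ⟨b, hb, rfl⟩ : a ∈ g '' (B \ (f '' X)) := by
        by_contra h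
        exact haX (hX ▸ ⟨ha, h⟩)
      rw [(hσ (g b) b).2 (.inr ⟨hb.1, hb.2, rfl⟩)]
      exact Option.some_ne_none _
  · obtain ⟨a, ha⟩ : ∃ a, σ a = some b := by
      by_cases hbX : b ∈ f '' X
      · obtain ⟨a, ha, hab⟩ := hbX
        exact ⟨a, (hσ a b).2 (.inl ⟨ha, hab⟩)⟩
      · exact ⟨g b, (hσ _ b).2 (.inr ⟨hb, hbX, rfl⟩)⟩
    rw [(PEquiv.eq_some_iff σ).2 ha]
    exact Option.some_ne_none _

/-- The Mendelsohn–Dulmage theorem for partially defined injections. -/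
theorem exists_pequiv_covering_of_injective (R : α → β → Prop) (A : Set α) (B : Set β) (f : A → β)
    (g : B → α) (hf : Function.Injective f) (hg : Function.Injective g)
    (hfR : ∀ a : A, R a (f a)) (hgR : ∀ b : B, R (g b) b) :
    ∃ σ : α ≃. β, (∀ a b, σ a = some b → R a b) ∧ (∀ a ∈ A, σ a ≠ none) ∧
      ∀ b ∈ B, σ.symm b ≠ none := by
  rcases isEmpty_or_nonempty α with hα | hα
  · exact ⟨⊥, fun a => hα.elim a, fun a => hα.elim a, fun b hb => hα.elim (g ⟨b, hb⟩)⟩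
  rcases isEmpty_or_nonempty β with hβ | hβ
  · exact ⟨⊥, fun _ b => hβ.elim b, fun a ha => hβ.elim (f ⟨a, ha⟩), fun b => hβ.elim b⟩
  obtain ⟨f', rfl⟩ : ∃ f' : α → β, f = fun a : A => f' a :=
    ⟨Function.extend Subtype.val f fun _ => Classical.arbitrary β, by
      ext1 a; exact (Subtype.val_injective.extend_apply f _ a).symm⟩
  obtain ⟨g', rfl⟩ : ∃ g' : β → α, g = fun b : B => g' b :=
    ⟨Function.extend Subtype.val g fun _ => Classical.arbitrary α, by
      ext1 b; exact (Subtype.val_injective.extend_apply g _ b).symm⟩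
  exact exists_pequiv_covering R A B f' g' (Set.injOn_iff_injective.2 hf)
    (Set.injOn_iff_injective.2 hg) (fun a ha => hfR ⟨a, ha⟩) fun b hb => hgR ⟨b, hb⟩

/-- A product of two matrices which is unitriangular up to a reordering has full rank. -/
lemma card_le_card_of_triangular {k : Type*} [Field k] {Γ : Type*} [LinearOrder Γ]
    (S : Finset α) (T : Finset β) (f : α → β → k) (g : β → α → k) (γ : α → Γ)
    [DecidableEq α]
    (h : ∀ a ∈ S, ∀ a' ∈ S, γ a ≤ γ a' →
      ∑ b ∈ T, f a b * g b a' = if a = a' then 1 else 0) : S.card ≤ T.card := by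
  classical
  by_contra! hlt
  let φ : (S → k) →ₗ[k] (T → k) :=
    { toFun := fun c b => ∑ a : S, c a * f a b
      map_add' := fun c c' => by ext b; simp [add_mul, Finset.sum_add_distrib]
      map_smul' := fun r c => by ext b; simp [Finset.mul_sum, mul_assoc] }
  have hker : LinearMap.ker φ ≠ ⊥ :=
    LinearMap.ker_ne_bot_of_finrank_lt (by simpa using hlt)
  obtain ⟨c, hc, hc0⟩ := Submodule.exists_mem_ne_zero_of_ne_bot hker
  have hne : (Finset.univ.filter fun a => c a ≠ 0).Nonempty := by
    obtain ⟨a, ha⟩ := Function.ne_iff.1 hc0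
    exact ⟨a, by simpa using ha⟩
  -- If `S` were larger than `T`, some nonzero combination `c` of the rows of `f` would vanish on
  -- `T`. Pairing it with column `a'` of `g`, for `a'` of maximal `γ` in the support of `c`, leaves
  -- exactly `c a'`.
  obtain ⟨a', ha', hmax⟩ := Finset.exists_max_image _ (fun a : S => γ a) hne
  have h0 : ∑ b ∈ T, (∑ a : S, c a * f a b) * g b a' = 0 := by
    refine Finset.sum_eq_zero fun b hb => ?_
    have : φ c ⟨b, hb⟩ = 0 := by rw [LinearMap.mem_ker.1 hc]; rfl
    change (∑ a : S, c a * f a b) = 0 at this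
    rw [this, zero_mul]
  have h1 : ∑ b ∈ T, (∑ a : S, c a * f a b) * g b a' = c a' := by
    simp_rw [Finset.sum_mul, mul_assoc]
    rw [Finset.sum_comm, Finset.sum_eq_single a']
    · rw [← Finset.mul_sum, h a' a'.2 a' a'.2 le_rfl, if_pos rfl, mul_one]
    · intro a _ hne
      rw [← Finset.mul_sum]
      by_cases hca : c a = 0
      · rw [hca, zero_mul]
      · rw [h a a.2 a' a'.2 (hmax a (by simpa using hca)),
          if_neg fun h => hne (Subtype.ext h), mul_zero]
    · simp
  exact (by simpa using ha' : c a' ≠ 0) (h1.symm.trans h0)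

end Matching

/-! ### Shifts of lower sets of real numbers -/

section LowerSets

/-- `D` is contained in the translate of `D'` by `ε`. -/
def ShiftLE (ε : ℝ) (D D' : Set ℝ) : Prop := ∀ r ∈ D, r - ε ∈ D'

open Classical in
/-- The kind of a lower set of real numbers: empty, proper, or everything. -/
def lowerRank (D : Set ℝ) : ℕ := if D = ∅ then 0 else if D = Set.univ then 2 else 1

lemma lowerRank_cases (D : Set ℝ) :
    (D = ∅ ∧ lowerRank D = 0) ∨ (D = Set.univ ∧ lowerRank D = 2) ∨
      (D.Nonempty ∧ D ≠ Set.univ ∧ lowerRank D = 1) := by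
  by_cases h : D = ∅
  · simp [h, lowerRank]
  · by_cases h' : D = Set.univ
    · simp [h', lowerRank]
    · simp [h, h', lowerRank, Set.nonempty_iff_ne_empty]

lemma lt_of_isLowerSet {D : Set ℝ} (hD : IsLowerSet D) {r s : ℝ} (hr : r ∈ D)
    (hs : s ∉ D) : r < s :=
  lt_of_not_ge fun h => hs (hD h hr)

lemma bddAbove_of_isLowerSet {D : Set ℝ} (hD : IsLowerSet D) (h : D ≠ Set.univ) : BddAbove D := by
  obtain ⟨s, hs⟩ := (Set.ne_univ_iff_exists_notMem D).1 h
  exact ⟨s, fun r hr => (lt_of_isLowerSet hD hr hs).le⟩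

lemma ShiftLE.lowerRank_le {ε : ℝ} {D D' : Set ℝ} (h : ShiftLE ε D D') :
    lowerRank D ≤ lowerRank D' := by
  rcases lowerRank_cases D with ⟨h1, h2⟩ | ⟨h1, h2⟩ | ⟨h1, h1', h2⟩
  · omega
  · have : D' = Set.univ := by
      refine Set.eq_univ_of_forall fun r => ?_
      simpa using h (r + ε) (h1 ▸ trivial)
    rw [h1, this]
  · rcases lowerRank_cases D' with ⟨h3, h4⟩ | ⟨h3, h4⟩ | ⟨h3, h3', h4⟩
    · obtain ⟨r, hr⟩ := h1
      have := h r hr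
      simp [h3] at this
    · omega
    · omega

lemma ShiftLE.sSup_le {ε : ℝ} {D D' : Set ℝ} (h : ShiftLE ε D D') (hD : D.Nonempty)
    (hD' : BddAbove D') : sSup D ≤ sSup D' + ε := by
  refine csSup_le hD fun r hr => ?_
  linarith [le_csSup hD' (h r hr)]

lemma le_sSup_of_not_shiftLE {ε : ℝ} {D D' : Set ℝ} (h : ¬ ShiftLE ε D D') (hD : BddAbove D)
    (hD' : IsLowerSet D') (hne : D'.Nonempty) : sSup D' + ε ≤ sSup D := by
  simp only [ShiftLE, not_forall] at h
  obtain ⟨r, hr, hr'⟩ := h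
  have h1 : sSup D' ≤ r - ε := csSup_le hne fun s hs => (lt_of_isLowerSet hD' hs hr').le
  linarith [le_csSup hD hr]

/-- The number `γ` is `sSup C`. Ranks can only drop from `D` through `C` to `D'`, so all three are
equal. For empty sets and for the whole line all suprema take the default value 0 and every shift
relation holds, so the inequalities remain true. -/
lemma exists_sSup_comparison {ε ε' : ℝ} (hε : 0 ≤ ε) {D C D' : Set ℝ}
    (hD : IsLowerSet D) (hC : IsLowerSet C) (hD' : IsLowerSet D') (h : ShiftLE ε C D)
    (h' : ShiftLE ε D' C) (hr : lowerRank D' = lowerRank D) :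
    ∃ γ : ℝ, γ ≤ sSup D + ε ∧ sSup D' ≤ γ + ε ∧ (¬ ShiftLE ε' D C → γ + ε' ≤ sSup D) ∧
      (¬ ShiftLE ε' C D' → sSup D' + ε' ≤ γ) := by
  have h1 := h.lowerRank_le
  have h2 := h'.lowerRank_le
  refine ⟨sSup C, ?_⟩
  rcases lowerRank_cases D with ⟨hd, hd'⟩ | ⟨hd, hd'⟩ | ⟨hd, hdu, hd'⟩ <;>
  rcases lowerRank_cases C with ⟨hc, hc'⟩ | ⟨hc, hc'⟩ | ⟨hc, hcu, hc'⟩ <;>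
  rcases lowerRank_cases D' with ⟨he, he'⟩ | ⟨he, he'⟩ | ⟨he, heu, he'⟩ <;> try omega
  · subst hd hc he
    simp [ShiftLE, hε]
  · subst hd hc he
    simp [ShiftLE, hε]
  · exact ⟨h.sSup_le hc (bddAbove_of_isLowerSet hD hdu),
      h'.sSup_le he (bddAbove_of_isLowerSet hC hcu),
      fun hn => le_sSup_of_not_shiftLE hn (bddAbove_of_isLowerSet hD hdu) hC hc,
      fun hn => le_sSup_of_not_shiftLE hn (bddAbove_of_isLowerSet hC hcu) hD' he⟩

/-- The order by which pairs of lower sets are compared: first their kinds, then the sums of their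
suprema. -/
def pairScore (D E : Set ℝ) : ℕ ×ₗ ℝ :=
  toLex (lowerRank D + lowerRank E, sSup D + sSup E)

/-- Each rank can only drop on the way to `(D', E')`, so a score that does not drop leaves both
ranks unchanged and the sums of suprema decide. -/
lemma pairScore_le {ε : ℝ} {D E C B D' E' : Set ℝ} (h1 : ShiftLE ε C D) (h2 : ShiftLE ε B E)
    (h3 : ShiftLE ε D' C) (h4 : ShiftLE ε E' B) (h : pairScore D E ≤ pairScore D' E') :
    lowerRank D' = lowerRank D ∧ lowerRank E' = lowerRank E ∧
      sSup D + sSup E ≤ sSup D' + sSup E' := by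
  have k1 := h1.lowerRank_le
  have k2 := h2.lowerRank_le
  have k3 := h3.lowerRank_le
  have k4 := h4.lowerRank_le
  rw [pairScore, pairScore, Prod.Lex.le_iff] at h
  rcases h with h | ⟨h, h'⟩
  · simp only [ofLex_toLex] at h
    omega
  · simp only [ofLex_toLex] at h h'
    exact ⟨by omega, by omega, h'⟩

/-- If `(C, B)` is a step on a way from `(D, E)` to a pair `(D', E')` which is not smaller, then it
is close to one of the two. -/
lemma shiftLE_or_of_pairScore_le {ε ε' : ℝ} (hε : 0 ≤ ε) (hεε' : ε < ε')
    {D E C B D' E' : Set ℝ} (hD : IsLowerSet D) (hE : IsLowerSet E) (hC : IsLowerSet C)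
    (hB : IsLowerSet B) (hD' : IsLowerSet D') (hE' : IsLowerSet E') (h1 : ShiftLE ε C D)
    (h2 : ShiftLE ε B E) (h3 : ShiftLE ε D' C) (h4 : ShiftLE ε E' B)
    (h : pairScore D E ≤ pairScore D' E') :
    (ShiftLE ε' D C ∧ ShiftLE ε' E B) ∨ (ShiftLE ε' C D' ∧ ShiftLE ε' B E') := by
  obtain ⟨k1, k2, k3⟩ := pairScore_le h1 h2 h3 h4 h
  obtain ⟨γ, l1, l2, l3, l4⟩ := exists_sSup_comparison (ε' := ε') hε hD hC hD' h1 h3 k1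
  obtain ⟨δ, m1, m2, m3, m4⟩ := exists_sSup_comparison (ε' := ε') hε hE hB hE' h2 h4 k2
  -- In each of the two steps some coordinate drops by at least `ε'` and the other grows by at most
  -- `ε`. The sum of suprema would change by at most `2ε - 2ε' < 0`.
  by_contra! hn
  obtain ⟨n1, n2⟩ := hn
  by_cases p1 : ShiftLE ε' D C
  · have := m3 (n1 p1)
    by_cases p2 : ShiftLE ε' C D'
    · have := m4 (n2 p2)
      linarith
    · have := l4 p2
      linarith
  · have := l3 p1
    by_cases p2 : ShiftLE ε' C D'
    · have := m4 (n2 p2)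
      linarith
    · have := l4 p2
      linarith

lemma ShiftLE.mono {ε ε' : ℝ} (h : ε ≤ ε') {D D' : Set ℝ} (hD' : IsLowerSet D')
    (hs : ShiftLE ε D D') : ShiftLE ε' D D' := fun r hr => hD' (by linarith) (hs r hr)

end LowerSets

/-! ### Intervals of the bipath poset -/

open Bipath

/-- The kinds of intervals of the bipath poset. -/
inductive IntervalKind : Type
  | whole : IntervalKind
  | down : IntervalKind
  | up : IntervalKind
  | line (i : Fin 2) : IntervalKind

namespace PosetInterval

lemma exists_line (I : PosetInterval Bipath) (h : negInf ∉ I.carrier) (h' : posInf ∉ I.carrier) :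
    ∃ i, ∀ p ∈ I.carrier, ∃ r, p = pt i r := by
  obtain ⟨p, hp⟩ := I.nonempty
  rcases p with _ | _ | ⟨i, r⟩
  · exact absurd hp h
  · exact absurd hp h'
  refine ⟨i, fun q hq => ?_⟩
  have hpath := I.connected _ hp q hq
  clear hq
  induction hpath with
  | refl => exact ⟨r, rfl⟩
  | @tail b c _ hbc ih =>
    obtain ⟨s, rfl⟩ := ih
    obtain ⟨-, hc, hbc⟩ := hbc
    rcases c with _ | _ | ⟨j, t⟩
    · exact absurd hc h
    · exact absurd hc h'
    · simp only [pt_le_pt_iff] at hbc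
      obtain rfl : i = j := by
        rcases hbc with ⟨h, -⟩ | ⟨h, -⟩
        exacts [h, h.symm]
      exact ⟨t, rfl⟩

open Classical in
/-- The kind of an interval of the bipath poset. -/
def kind (I : PosetInterval Bipath) : IntervalKind :=
  if h : negInf ∈ I.carrier then (if posInf ∈ I.carrier then .whole else .down)
  else if h' : posInf ∈ I.carrier then .up else .line (I.exists_line h h').choose

/-- The points of an interval on the `i`-th line. -/
def arm (I : PosetInterval Bipath) (i : Fin 2) : Set ℝ := {r | pt i r ∈ I.carrier}

/-- The first coordinate of an interval of the bipath poset. -/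
def lo (I : PosetInterval Bipath) : Set ℝ :=
  match I.kind with
  | .whole => I.arm 0
  | .down => I.arm 0
  | .up => (I.arm 0)ᶜ
  | .line i => {r | ∀ s ∈ I.arm i, r < s}

/-- The second coordinate of an interval of the bipath poset. -/
def hi (I : PosetInterval Bipath) : Set ℝ :=
  match I.kind with
  | .whole => I.arm 1
  | .down => I.arm 1
  | .up => (I.arm 1)ᶜ
  | .line i => {r | ∃ s ∈ I.arm i, r ≤ s}

lemma kind_of_negInf_of_posInf {I : PosetInterval Bipath} (h : negInf ∈ I.carrier)
    (h' : posInf ∈ I.carrier) : I.kind = .whole := by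
  simp [kind, h, h']

lemma kind_of_negInf {I : PosetInterval Bipath} (h : negInf ∈ I.carrier)
    (h' : posInf ∉ I.carrier) : I.kind = .down := by
  simp [kind, h, h']

lemma kind_of_posInf {I : PosetInterval Bipath} (h : negInf ∉ I.carrier)
    (h' : posInf ∈ I.carrier) : I.kind = .up := by
  simp [kind, h, h']

lemma exists_kind_eq_line {I : PosetInterval Bipath} (h : negInf ∉ I.carrier)
    (h' : posInf ∉ I.carrier) :
    ∃ i, I.kind = .line i ∧ ∀ p ∈ I.carrier, ∃ r, p = pt i r :=
  ⟨(I.exists_line h h').choose, by simp [kind, h, h'], (I.exists_line h h').choose_spec⟩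

lemma kind_eq_line {I : PosetInterval Bipath} (h : negInf ∉ I.carrier)
    (h' : posInf ∉ I.carrier) {i : Fin 2} {r : ℝ} (hr : pt i r ∈ I.carrier) :
    I.kind = .line i := by
  obtain ⟨j, hj, hl⟩ := exists_kind_eq_line h h'
  obtain ⟨s, hs⟩ := hl _ hr
  rw [hj, (pt.inj hs).1]

/-- The points of an interval of the kind of a line all lie on this line. -/
lemma eq_pt_of_kind {I : PosetInterval Bipath} {i : Fin 2} (h : I.kind = .line i) :
    ∀ p ∈ I.carrier, ∃ r, p = pt i r := by
  by_cases hn : negInf ∈ I.carrier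
  · by_cases hp : posInf ∈ I.carrier
    · simp [kind_of_negInf_of_posInf hn hp] at h
    · simp [kind_of_negInf hn hp] at h
  · by_cases hp : posInf ∈ I.carrier
    · simp [kind_of_posInf hn hp] at h
    · obtain ⟨j, hj, hl⟩ := exists_kind_eq_line hn hp
      rw [h] at hj
      rwa [IntervalKind.line.inj hj]

lemma kind_eq_cases {I J : PosetInterval Bipath} (h : I.kind = J.kind) :
    (negInf ∈ I.carrier ∧ negInf ∈ J.carrier ∧ (posInf ∈ I.carrier ↔ posInf ∈ J.carrier)) ∨
    (negInf ∉ I.carrier ∧ negInf ∉ J.carrier ∧ posInf ∈ I.carrier ∧ posInf ∈ J.carrier) ∨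
    ∃ i, I.kind = .line i ∧ J.kind = .line i := by
  by_cases hn : negInf ∈ I.carrier <;> by_cases hp : posInf ∈ I.carrier <;>
  by_cases hn' : negInf ∈ J.carrier <;> by_cases hp' : posInf ∈ J.carrier
  all_goals first
    | (exfalso; simp [kind, *] at h; done)
    | exact .inl ⟨hn, hn', iff_of_true hp hp'⟩
    | exact .inl ⟨hn, hn', iff_of_false hp hp'⟩
    | exact .inr (.inl ⟨hn, hn', hp, hp'⟩)
    | exact .inr (.inr ((exists_kind_eq_line hn hp).imp fun i hi => ⟨hi.1, h ▸ hi.1⟩))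

/-- The coordinates of `J` are at most those of `I` plus `ε`. -/
def CoordLE (ε : ℝ) (J I : PosetInterval Bipath) : Prop :=
  ShiftLE ε J.lo I.lo ∧ ShiftLE ε J.hi I.hi

lemma lo_hi_of_negInf {I : PosetInterval Bipath} (h : negInf ∈ I.carrier) :
    I.lo = I.arm 0 ∧ I.hi = I.arm 1 := by
  by_cases hp : posInf ∈ I.carrier
  · simp [lo, hi, kind_of_negInf_of_posInf h hp]
  · simp [lo, hi, kind_of_negInf h hp]

lemma lo_hi_of_posInf {I : PosetInterval Bipath} (h : negInf ∉ I.carrier)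
    (h' : posInf ∈ I.carrier) : I.lo = (I.arm 0)ᶜ ∧ I.hi = (I.arm 1)ᶜ := by
  simp [lo, hi, kind_of_posInf h h']

lemma lo_hi_of_line {I : PosetInterval Bipath} {i : Fin 2} (h : I.kind = .line i) :
    I.lo = {r | ∀ s ∈ I.arm i, r < s} ∧ I.hi = {r | ∃ s ∈ I.arm i, r ≤ s} := by
  simp [lo, hi, h]

lemma coordLE_iff_of_negInf {ε : ℝ} {I J : PosetInterval Bipath} (hI : negInf ∈ I.carrier)
    (hJ : negInf ∈ J.carrier) :
    CoordLE ε J I ↔ ∀ i r, pt i r ∈ J.carrier → pt i (r - ε) ∈ I.carrier := by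
  rw [CoordLE, (lo_hi_of_negInf hI).1, (lo_hi_of_negInf hI).2, (lo_hi_of_negInf hJ).1,
    (lo_hi_of_negInf hJ).2, Fin.forall_fin_two]
  rfl

lemma coordLE_iff_of_posInf {ε : ℝ} {I J : PosetInterval Bipath} (hI : negInf ∉ I.carrier)
    (hI' : posInf ∈ I.carrier) (hJ : negInf ∉ J.carrier) (hJ' : posInf ∈ J.carrier) :
    CoordLE ε J I ↔ ∀ i r, pt i r ∉ J.carrier → pt i (r - ε) ∉ I.carrier := by
  rw [CoordLE, (lo_hi_of_posInf hI hI').1, (lo_hi_of_posInf hI hI').2, (lo_hi_of_posInf hJ hJ').1,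
    (lo_hi_of_posInf hJ hJ').2, Fin.forall_fin_two]
  rfl

lemma coordLE_iff_of_line {ε : ℝ} {I J : PosetInterval Bipath} {i : Fin 2}
    (hI : I.kind = .line i) (hJ : J.kind = .line i) :
    CoordLE ε J I ↔
      (∀ r, (∀ s, pt i s ∈ J.carrier → r < s) → ∀ s, pt i s ∈ I.carrier → r - ε < s) ∧
      (∀ r, pt i r ∈ J.carrier → ∃ s, pt i s ∈ I.carrier ∧ r - ε ≤ s) := by
  rw [CoordLE, (lo_hi_of_line hI).1, (lo_hi_of_line hI).2, (lo_hi_of_line hJ).1,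
    (lo_hi_of_line hJ).2]
  refine and_congr Iff.rfl ⟨fun h r hr => h r ⟨r, hr, le_rfl⟩, fun h r ⟨s, hs, hrs⟩ => ?_⟩
  obtain ⟨t, ht, hst⟩ := h s hs
  exact ⟨t, ht, by linarith⟩

lemma isLowerSet_lo_hi (I : PosetInterval Bipath) : IsLowerSet I.lo ∧ IsLowerSet I.hi := by
  by_cases hn : negInf ∈ I.carrier
  · rw [(lo_hi_of_negInf hn).1, (lo_hi_of_negInf hn).2]
    exact ⟨fun r s hrs hr => I.convex _ hn _ hr _ (by simp) (by simpa using hrs),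
      fun r s hrs hr => I.convex _ hn _ hr _ (by simp) (by simpa using hrs)⟩
  by_cases hp : posInf ∈ I.carrier
  · rw [(lo_hi_of_posInf hn hp).1, (lo_hi_of_posInf hn hp).2]
    exact ⟨fun r s hrs hr hs => hr (I.convex _ hs _ hp _ (by simpa using hrs) (by simp)),
      fun r s hrs hr hs => hr (I.convex _ hs _ hp _ (by simpa using hrs) (by simp))⟩
  · obtain ⟨i, hi, -⟩ := exists_kind_eq_line hn hp
    rw [(lo_hi_of_line hi).1, (lo_hi_of_line hi).2]
    exact ⟨fun r s hrs hr t ht => hrs.trans_lt (hr t ht),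
      fun r s hrs ⟨t, ht, hrt⟩ => ⟨t, ht, hrs.trans hrt⟩⟩

end PosetInterval

@[simp] lemma bipathAction_negInf (ε : ℝ≥0) : bipathAction.act ε negInf = negInf := rfl
@[simp] lemma bipathAction_posInf (ε : ℝ≥0) : bipathAction.act ε posInf = posInf := rfl
@[simp] lemma bipathAction_pt (ε : ℝ≥0) (i : Fin 2) (r : ℝ) :
    bipathAction.act ε (pt i r) = pt i (r + ε) := rfl

lemma bipathAction_le_iff (ε : ℝ≥0) (p q : Bipath) :
    bipathAction.act ε p ≤ bipathAction.act ε q ↔ p ≤ q := by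
  cases p <;> cases q <;> simp

lemma bipathAction_surjective (ε : ℝ≥0) : Function.Surjective (bipathAction.act ε) := by
  rintro (_ | _ | ⟨i, r⟩)
  exacts [⟨negInf, rfl⟩, ⟨posInf, rfl⟩, ⟨pt i (r - ε), by simp⟩]

lemma mem_thickening_iff (ε : ℝ≥0) (I : PosetInterval Bipath) (p : Bipath) :
    p ∈ thickening bipathAction ε I.carrier ↔
      (∃ a, bipathAction.act ε a ∈ I.carrier ∧ a ≤ p) ∧
      ∃ a ∈ I.carrier, p ≤ bipathAction.act ε a := by
  have h1 : (bipathAction.act ε ⁻¹' I.carrier).Nonempty :=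
    I.nonempty.preimage (bipathAction_surjective ε)
  have h2 : (bipathAction.act ε '' I.carrier).Nonempty := I.nonempty.image _
  simp [thickening, upset, downset, h1, h2]

open PosetInterval

/-- An infinite point of `I` provides one of the two bounds required by the thickening, whatever `p`
is; the coordinates provide the other bounds. -/
lemma subset_thickening {ε : ℝ≥0} {I J : PosetInterval Bipath} (hIJ : I.kind = J.kind)
    (h : CoordLE ε J I) (h' : CoordLE ε I J) : J.carrier ⊆ thickening bipathAction ε I.carrier := by
  intro p hp
  rw [mem_thickening_iff]
  rcases kind_eq_cases hIJ with ⟨hI, hJ, hinf⟩ | ⟨hI, hJ, hI', hJ'⟩ | ⟨i, hI, hJ⟩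
  · rw [coordLE_iff_of_negInf hI hJ] at h
    refine ⟨⟨negInf, hI, negInf_le p⟩, ?_⟩
    rcases p with _ | _ | ⟨i, r⟩
    · exact ⟨negInf, hI, by simp⟩
    · exact ⟨posInf, hinf.2 hp, by simp⟩
    · exact ⟨_, h i r hp, by simp⟩
  · rw [coordLE_iff_of_posInf hJ hJ' hI hI'] at h'
    refine ⟨?_, ⟨posInf, hI', le_posInf p⟩⟩
    rcases p with _ | _ | ⟨i, r⟩
    · exact absurd hp hJ
    · exact ⟨posInf, hI', by simp⟩
    · refine ⟨pt i r, ?_, le_rfl⟩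
      by_contra hr
      exact h' i _ hr (by simpa using hp)
  · rw [coordLE_iff_of_line hI hJ] at h
    rw [coordLE_iff_of_line hJ hI] at h'
    obtain ⟨r, rfl⟩ := eq_pt_of_kind hJ p hp
    constructor
    · by_contra! hr
      have h1 : ∀ s, pt i s ∈ I.carrier → r + ε < s := by
        intro s hs
        have := hr (pt i (s - ε)) (by simpa using hs)
        simp only [pt_le_pt_iff, true_and, not_le] at this
        linarith
      have := h'.1 _ h1 r hp
      simp at this
    · obtain ⟨s, hs, hrs⟩ := h.2 r hp
      exact ⟨_, hs, by simpa [sub_le_iff_le_add] using hrs⟩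

/-! ### Matrices of morphisms into shifts -/

section TransitionMatrix

variable {k : Type u} [Field k] {ι κ : Type*} {I : ι → PosetInterval Bipath}
  {J : κ → PosetInterval Bipath} {ε : ℝ≥0}

/-- The conditions on the matrix entries, at all points, of a morphism from a sum of interval
modules to the `ε`-shift of another one. -/
structure IsMorphismMatrix (ε : ℝ≥0) (I : ι → PosetInterval Bipath) (J : κ → PosetInterval Bipath)
    (F : Bipath → ι → κ → k) : Prop where
  support : ∀ p a b, F p a b ≠ 0 → p ∈ (I a).carrier ∧ bipathAction.act ε p ∈ (J b).carrier
  naturality : ∀ p q a b, p ≤ q → p ∈ (I a).carrier → bipathAction.act ε q ∈ (J b).carrier →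
    F p a b = F q a b

namespace IsMorphismMatrix

variable {F : Bipath → ι → κ → k}

/-- Naturality carries the nonzero entry to an infinite point common to both intervals, or along
their common line. From there it reaches the point in question, where a nonzero entry forces
membership. -/
lemma coordLE (hF : IsMorphismMatrix ε I J F) {p : Bipath} {a : ι} {b : κ}
    (hab : (I a).kind = (J b).kind) (h : F p a b ≠ 0) :
    CoordLE ε (J b) (I a) := by
  obtain ⟨h1, h2⟩ := hF.support p a b h
  rcases kind_eq_cases hab with ⟨hI, hJ, hinf⟩ | ⟨hI, hJ, hI', hJ'⟩ | ⟨i, hI, hJ⟩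
  · rw [coordLE_iff_of_negInf hI hJ]
    intro i r hr
    have hne : F negInf a b ≠ 0 := by rwa [hF.naturality negInf p a b (by simp) hI h2]
    rw [hF.naturality negInf (pt i (r - ε)) a b (by simp) hI (by simpa using hr)] at hne
    exact (hF.support _ _ _ hne).1
  · rw [coordLE_iff_of_posInf hI hI' hJ hJ']
    intro i r hr hr'
    have hne : F posInf a b ≠ 0 := by rwa [← hF.naturality p posInf a b (by simp) h1 hJ']
    rw [← hF.naturality (pt i (r - ε)) posInf a b (by simp) hr' hJ'] at hne
    exact hr (by simpa using (hF.support _ _ _ hne).2)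
  · rw [coordLE_iff_of_line hI hJ]
    obtain ⟨t, rfl⟩ := eq_pt_of_kind hI p h1
    constructor
    · intro r hr s hs
      by_contra! hsr
      have hrt := hr _ h2
      have hne : F (pt i s) a b ≠ 0 := by
        rwa [hF.naturality (pt i s) (pt i t) a b (by simp; linarith) hs h2]
      have := hr _ (hF.support _ _ _ hne).2
      linarith
    · intro s hs
      by_cases hst : s - ε ≤ t
      · exact ⟨t, h1, hst⟩
      · have hne : F (pt i (s - ε)) a b ≠ 0 := by
          rwa [← hF.naturality (pt i t) (pt i (s - ε)) a b (by simp; linarith) h1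
            (by simpa using hs)]
        exact ⟨_, (hF.support _ _ _ hne).1, le_rfl⟩

lemma eq_of_kind_eq (hF : IsMorphismMatrix ε I J F) {p q : Bipath} {a : ι} {b : κ}
    (hab : (I a).kind = (J b).kind)
    (hp : p ∈ (I a).carrier) (hp' : bipathAction.act ε p ∈ (J b).carrier)
    (hq : q ∈ (I a).carrier) (hq' : bipathAction.act ε q ∈ (J b).carrier) :
    F p a b = F q a b := by
  rcases kind_eq_cases hab with ⟨hI, hJ, hinf⟩ | ⟨hI, hJ, hI', hJ'⟩ | ⟨i, hI, hJ⟩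
  · rw [← hF.naturality negInf p a b (by simp) hI hp', hF.naturality negInf q a b (by simp) hI hq']
  · rw [hF.naturality p posInf a b (by simp) hp hJ', hF.naturality q posInf a b (by simp) hq hJ']
  · obtain ⟨r, rfl⟩ := eq_pt_of_kind hI p hp
    obtain ⟨s, rfl⟩ := eq_pt_of_kind hI q hq
    rcases le_total r s with h | h
    · exact hF.naturality _ _ a b (by simpa using h) hp hq'
    · exact (hF.naturality _ _ a b (by simpa using h) hq hp').symm

end IsMorphismMatrix

end TransitionMatrix

/-- An interval is `ε`-significant if it contains a point together with its `2ε`-shift. -/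
def Significant (ε : ℝ≥0) (I : PosetInterval Bipath) : Prop :=
  ∃ p ∈ I.carrier, bipathAction.act (2 * ε) p ∈ I.carrier

/-- Two intervals are `ε`-close if each lies in the `ε`-thickening of the other. -/
def Close (ε : ℝ≥0) (I J : PosetInterval Bipath) : Prop :=
  I.carrier ⊆ thickening bipathAction ε J.carrier ∧ J.carrier ⊆ thickening bipathAction ε I.carrier

lemma Close.symm {ε : ℝ≥0} {I J : PosetInterval Bipath} (h : Close ε I J) : Close ε J I :=
  ⟨h.2, h.1⟩

lemma close_of_coordLE {ε : ℝ≥0} {I J : PosetInterval Bipath} (hIJ : I.kind = J.kind)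
    (h : CoordLE ε J I) (h' : CoordLE ε I J) : Close ε I J :=
  ⟨subset_thickening hIJ.symm h' h, subset_thickening hIJ h h'⟩

/-- Consequently all intervals close to a given significant one share a point, which makes the
neighbourhoods in Hall's theorem finite. -/
lemma Close.act_mem {ε : ℝ≥0} {I J : PosetInterval Bipath} (h : Close ε I J) {p : Bipath}
    (hp : p ∈ I.carrier) (hp' : bipathAction.act (2 * ε) p ∈ I.carrier) :
    bipathAction.act ε p ∈ J.carrier := by
  obtain ⟨⟨a, ha, hap⟩, -⟩ := (mem_thickening_iff ε J p).1 (h.1 hp)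
  obtain ⟨-, b, hb, hpb⟩ := (mem_thickening_iff ε J _).1 (h.1 hp')
  rw [two_mul, bipathAction.act_add, bipathAction_le_iff] at hpb
  exact J.convex _ ha _ hb _ ((bipathAction_le_iff ε _ _).2 hap) hpb

/-- The order by which intervals of the same kind are compared. -/
def score (I : PosetInterval Bipath) : ℕ ×ₗ ℝ := pairScore I.lo I.hi

lemma close_or_close {ε ε' : ℝ≥0} (hε : ε < ε') {I J I' : PosetInterval Bipath}
    (hIJ : I.kind = J.kind) (hJI' : J.kind = I'.kind) (h : CoordLE ε J I) (h' : CoordLE ε I' J)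
    (hs : score I ≤ score I') : Close ε' I J ∨ Close ε' I' J := by
  have hε' : (ε : ℝ) ≤ ε' := hε.le
  rcases shiftLE_or_of_pairScore_le ε.2 (show (ε : ℝ) < ε' from hε) I.isLowerSet_lo_hi.1
    I.isLowerSet_lo_hi.2 J.isLowerSet_lo_hi.1 J.isLowerSet_lo_hi.2 I'.isLowerSet_lo_hi.1
    I'.isLowerSet_lo_hi.2 h.1 h.2 h'.1 h'.2 hs with hc | hc
  · exact .inl (close_of_coordLE hIJ ⟨h.1.mono hε' I.isLowerSet_lo_hi.1,
      h.2.mono hε' I.isLowerSet_lo_hi.2⟩ hc)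
  · exact .inr (close_of_coordLE hJI' ⟨h'.1.mono hε' J.isLowerSet_lo_hi.1,
      h'.2.mono hε' J.isLowerSet_lo_hi.2⟩ hc).symm

lemma lowerRank_eq_one {D : Set ℝ} (h : D.Nonempty) (h' : BddAbove D) : lowerRank D = 1 := by
  rcases lowerRank_cases D with ⟨rfl, -⟩ | ⟨rfl, -⟩ | ⟨-, -, h⟩
  · exact absurd h Set.not_nonempty_empty
  · exact absurd h' not_bddAbove_univ
  · exact h

lemma bddAbove_of_lowerRank {D : Set ℝ} (hD : IsLowerSet D) (h : lowerRank D = 1) :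
    D.Nonempty ∧ BddAbove D := by
  rcases lowerRank_cases D with ⟨rfl, h2⟩ | ⟨rfl, h2⟩ | ⟨h1, h2, -⟩
  · omega
  · omega
  · exact ⟨h1, bddAbove_of_isLowerSet hD h2⟩

/-- Two disjoint intervals of real numbers lie on different sides of each other. -/
lemma forall_lt_of_disjoint {A B : Set ℝ} (hA : A.OrdConnected) (hB : B.OrdConnected)
    (h : Disjoint A B) {t t' : ℝ} (ht : t ∈ A) (ht' : t' ∈ B) (htt' : t < t') :
    ∀ s ∈ A, ∀ s' ∈ B, s < s' := by
  intro s hs s' hs'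
  by_contra! hlt
  rw [Set.disjoint_left] at h
  rcases le_total t s' with h1 | h1
  · exact h (hA.out ht hs ⟨h1, hlt⟩) hs'
  · exact h ht (hB.out hs' ht' ⟨h1, htt'.le⟩)

lemma ordConnected_arm (I : PosetInterval Bipath) (i : Fin 2) : (I.arm i).OrdConnected :=
  ⟨fun _ hx _ hy _ hz => I.convex _ hx _ hy _ (by simpa using hz.1) (by simpa using hz.2)⟩

/-- A common infinite point settles all kinds except lines. On a line, if `I` and `I'` moved down by
`2ε` were disjoint, one would lie to the left of the other, and both orders are excluded. -/
lemma exists_mem_act_mem {ε ε' : ℝ≥0} (hε : ε < ε') {I J I' : PosetInterval Bipath}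
    (hIJ : I.kind = J.kind) (hJI' : J.kind = I'.kind) (h : CoordLE ε J I) (h' : CoordLE ε I' J)
    (hs : score I ≤ score I') (hI : Significant ε' I) (hI' : Significant ε' I') :
    ∃ p ∈ I.carrier, bipathAction.act ε (bipathAction.act ε p) ∈ I'.carrier := by
  have hε' : (ε : ℝ) < ε' := hε
  rcases kind_eq_cases (hIJ.trans hJI') with ⟨h1, h2, -⟩ | ⟨-, -, h1, h2⟩ | ⟨i, h1, h2⟩
  · exact ⟨negInf, h1, h2⟩
  · exact ⟨posInf, h1, h2⟩
  by_contra! hno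
  obtain ⟨p, hp, hp'⟩ := hI
  obtain ⟨t, rfl⟩ := eq_pt_of_kind h1 p hp
  obtain ⟨p', hq, hq'⟩ := hI'
  obtain ⟨t', rfl⟩ := eq_pt_of_kind h2 p' hq
  simp only [bipathAction_pt, NNReal.coe_mul, NNReal.coe_ofNat] at hp' hq'
  have hdisj : Disjoint (I.arm i) ((fun s => s + 2 * (ε : ℝ)) ⁻¹' I'.arm i) := by
    rw [Set.disjoint_left]
    intro s hs hs'
    refine hno _ hs ?_
    simp only [bipathAction_pt]
    rw [add_assoc, ← two_mul]
    exact hs'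
  have hB : ((fun s => s + 2 * (ε : ℝ)) ⁻¹' I'.arm i).OrdConnected :=
    (ordConnected_arm I' i).preimage_mono fun a b hab => by simpa using hab
  have ht' : t' - 2 * (ε : ℝ) ∈ (fun s => s + 2 * (ε : ℝ)) ⁻¹' I'.arm i := by
    simpa using (show t' ∈ I'.arm i from hq)
  have hlt : ∀ {s}, s ∈ I'.arm i → s - 2 * (ε : ℝ) ∈ (fun s => s + 2 * (ε : ℝ)) ⁻¹' I'.arm i := by
    intro s hs
    simpa using hs
  obtain ⟨lI, uI⟩ := lo_hi_of_line h1
  obtain ⟨lI', uI'⟩ := lo_hi_of_line h2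
  rcases lt_trichotomy t (t' - 2 * (ε : ℝ)) with hc | hc | hc
  -- Here `I` lies on the left, so the lower end of `I'` exceeds that of `I` by more than the `2ε`
  -- allowed by the coordinates.
  · have hall := forall_lt_of_disjoint (ordConnected_arm I i) hB hdisj hp ht' hc
    have hr : t + 2 * ε' + 2 * ε ∈ I'.lo := by
      rw [lI']
      intro s hs
      have := hall _ hp' _ (hlt hs)
      linarith
    have hr' := h.1 _ (h'.1 _ hr)
    rw [lI] at hr'
    have := hr' _ hp'
    linarith
  · exact Set.disjoint_left.1 hdisj hp (hc ▸ ht')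
  -- Here `I` lies on the right. Both intervals have length at least `2ε'`, so the endpoint sum of
  -- `I'` would be smaller than that of `I`, against the order of scores. The ranks make the suprema
  -- genuine.
  · have hall := forall_lt_of_disjoint hB (ordConnected_arm I i) hdisj.symm ht' hp hc
    obtain ⟨k1, k2, k3⟩ := pairScore_le h.1 h.2 h'.1 h'.2 hs
    have m1 : ∀ s ∈ I'.arm i, s - 2 * (ε : ℝ) ∈ I.lo := by
      intro s hs
      rw [lI]
      exact fun r hr => hall _ (hlt hs) _ hr
    have n1 : I.lo.Nonempty := ⟨_, m1 _ hq⟩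
    have b1 : BddAbove I.lo := ⟨t, fun r hr => by rw [lI] at hr; exact (hr t hp).le⟩
    have n4 : I'.hi.Nonempty := ⟨t', by rw [uI']; exact ⟨t', hq, le_rfl⟩⟩
    have b4 : BddAbove I'.hi := ⟨t + 2 * ε, fun r hr => by
      rw [uI'] at hr
      obtain ⟨s, hs, hrs⟩ := hr
      have := hall _ (hlt hs) _ hp
      linarith⟩
    obtain ⟨n2, b2⟩ := bddAbove_of_lowerRank I.isLowerSet_lo_hi.2
      (k2.symm.trans (lowerRank_eq_one n4 b4))
    obtain ⟨n3, b3⟩ := bddAbove_of_lowerRank I'.isLowerSet_lo_hi.1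
      (k1.trans (lowerRank_eq_one n1 b1))
    have e1 : sSup I'.hi ≤ sSup I.lo + 2 * ε := by
      refine csSup_le n4 fun r hr => ?_
      rw [uI'] at hr
      obtain ⟨s, hs, hrs⟩ := hr
      linarith [le_csSup b1 (m1 s hs)]
    have e2 : sSup I.lo ≤ t := csSup_le n1 fun r hr => by rw [lI] at hr; exact (hr t hp).le
    have e3 : t + 2 * ε' ≤ sSup I.hi := le_csSup b2 (by rw [uI]; exact ⟨_, hp', le_rfl⟩)
    have e4 : sSup I'.lo ≤ t' := csSup_le n3 fun r hr => by rw [lI'] at hr; exact (hr t' hq).le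
    have e5 : t' + 2 * ε' ≤ sSup I'.hi := le_csSup b4 (by rw [uI']; exact ⟨_, hq', le_rfl⟩)
    linarith

/-! ### The induced matching -/

section InducedMatching

variable {k : Type u} [Field k] {ι κ : Type*} {I : ι → PosetInterval Bipath}
  {J : κ → PosetInterval Bipath} {ε : ℝ≥0}

open Classical in
/-- The common value of the entries of a morphism matrix between intervals of the same kind. -/
def morphismScalar (ε : ℝ≥0) (I : ι → PosetInterval Bipath) (J : κ → PosetInterval Bipath)
    (F : Bipath → ι → κ → k) (a : ι) (b : κ) : k :=
  if h : (I a).kind = (J b).kind ∧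
      ∃ p, p ∈ (I a).carrier ∧ bipathAction.act ε p ∈ (J b).carrier then F h.2.choose a b else 0

namespace IsMorphismMatrix

variable {F : Bipath → ι → κ → k} {G : Bipath → κ → ι → k}

lemma morphismScalar_eq (hF : IsMorphismMatrix ε I J F) {a : ι} {b : κ} {p : Bipath}
    (hab : (I a).kind = (J b).kind) (hp : p ∈ (I a).carrier)
    (hp' : bipathAction.act ε p ∈ (J b).carrier) : morphismScalar ε I J F a b = F p a b := by
  have h : (I a).kind = (J b).kind ∧
      ∃ p, p ∈ (I a).carrier ∧ bipathAction.act ε p ∈ (J b).carrier := ⟨hab, p, hp, hp'⟩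
  rw [morphismScalar, dif_pos h]
  exact hF.eq_of_kind_eq hab h.2.choose_spec.1 h.2.choose_spec.2 hp hp'

lemma exists_of_morphismScalar_ne_zero {a : ι} {b : κ} (h : morphismScalar ε I J F a b ≠ 0) :
    (I a).kind = (J b).kind ∧ ∃ p, F p a b ≠ 0 := by
  rw [morphismScalar] at h
  split_ifs at h with h'
  · exact ⟨h'.1, _, h⟩
  · exact absurd rfl h

lemma coordLE_of_morphismScalar_ne_zero (hF : IsMorphismMatrix ε I J F) {a : ι} {b : κ}
    (h : morphismScalar ε I J F a b ≠ 0) : CoordLE ε (J b) (I a) := by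
  obtain ⟨hab, p, hp⟩ := exists_of_morphismScalar_ne_zero h
  exact hF.coordLE hab hp

/-- If `p + ε` were outside `J b`, naturality would confine the nonzero entries of `F` to points not
above `p`, and those of `G` to points not below `p + ε`. An infinite point contradicts this at once;
on a line, `p + ε` would lie between two points of the convex set `J b`. -/
lemma act_mem_of_ne_zero (hF : IsMorphismMatrix ε I J F) (hG : IsMorphismMatrix ε J I G)
    {a a' : ι} {b : κ} (hab : (I a).kind = (J b).kind) {p q r : Bipath}
    (hq : F q a b ≠ 0) (hr : G r b a' ≠ 0) (hp : p ∈ (I a).carrier)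
    (hp' : bipathAction.act ε (bipathAction.act ε p) ∈ (I a').carrier) :
    bipathAction.act ε p ∈ (J b).carrier := by
  obtain ⟨hq1, hq2⟩ := hF.support _ _ _ hq
  obtain ⟨hr1, hr2⟩ := hG.support _ _ _ hr
  by_contra hpJ
  have hF0 : ∀ q', p ≤ q' → F q' a b ≠ 0 → False := by
    intro q' h h'
    rw [← hF.naturality p q' a b h hp (hF.support _ _ _ h').2] at h'
    exact hpJ (hF.support _ _ _ h').2
  have hG0 : ∀ r', r' ≤ bipathAction.act ε p → G r' b a' ≠ 0 → False := by
    intro r' h h'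
    rw [hG.naturality r' _ b a' h (hG.support _ _ _ h').1 hp'] at h'
    exact hpJ (hG.support _ _ _ h').1
  rcases kind_eq_cases hab with ⟨hI, hJ, -⟩ | ⟨hI, hJ, hI', hJ'⟩ | ⟨i, hI, hJ⟩
  · refine hG0 negInf (by simp) ?_
    rwa [hG.naturality negInf r b a' (by simp) hJ hr2]
  · refine hF0 posInf (by simp) ?_
    rwa [← hF.naturality q posInf a b (by simp) hq1 hJ']
  · obtain ⟨s, rfl⟩ := eq_pt_of_kind hI p hp
    obtain ⟨t, rfl⟩ := eq_pt_of_kind hI q hq1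
    obtain ⟨v, rfl⟩ := eq_pt_of_kind hJ r hr1
    have h1 : t < s := by
      by_contra! h
      exact hF0 _ (by simpa using h) hq
    have h2 : s + ε < v := by
      by_contra! h
      exact hG0 _ (by simpa using h) hr
    exact hpJ ((J b).convex _ hq2 _ hr1 _ (by simpa using h1.le) (by simpa using h2.le))

/-- Nonzero maps carry -∞ forward and +∞ backward between intervals, so an interval through which
two intervals of one kind are linked has that kind too. -/
lemma kind_eq_of_ne_zero (hF : IsMorphismMatrix ε I J F) (hG : IsMorphismMatrix ε J I G)
    {a a' : ι} {b : κ} (haa' : (I a).kind = (I a').kind) {p : Bipath} (hp : F p a b ≠ 0)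
    (hp' : G (bipathAction.act ε p) b a' ≠ 0) : (I a).kind = (J b).kind := by
  obtain ⟨h1, h2⟩ := hF.support _ _ _ hp
  obtain ⟨-, h3⟩ := hG.support _ _ _ hp'
  have hn : negInf ∈ (J b).carrier → negInf ∈ (I a').carrier := by
    intro h
    rw [← hG.naturality negInf _ b a' (by simp) h h3] at hp'
    exact (hG.support _ _ _ hp').2
  have hn' : negInf ∈ (I a).carrier → negInf ∈ (J b).carrier := by
    intro h
    rw [← hF.naturality negInf _ a b (by simp) h h2] at hp
    exact (hF.support _ _ _ hp).2
  have hi : posInf ∈ (J b).carrier → posInf ∈ (I a).carrier := by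
    intro h
    rw [hF.naturality _ posInf a b (by simp) h1 h] at hp
    exact (hF.support _ _ _ hp).1
  have hi' : posInf ∈ (I a').carrier → posInf ∈ (J b).carrier := by
    intro h
    rw [hG.naturality _ posInf b a' (by simp) h2 h] at hp'
    exact (hG.support _ _ _ hp').1
  rcases kind_eq_cases haa' with ⟨hI, hI', hinf⟩ | ⟨hI, hI', hinf, hinf'⟩ | ⟨i, hI, hI'⟩
  · by_cases h : posInf ∈ (I a).carrier
    · rw [kind_of_negInf_of_posInf hI h, kind_of_negInf_of_posInf (hn' hI) (hi' (hinf.1 h))]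
    · rw [kind_of_negInf hI h, kind_of_negInf (hn' hI) (mt hi h)]
  · rw [kind_of_posInf hI hinf, kind_of_posInf (mt hn hI') (hi' hinf')]
  · obtain ⟨s, rfl⟩ := eq_pt_of_kind hI p h1
    have hni : negInf ∉ (J b).carrier := fun h => by
      obtain ⟨r, hr⟩ := eq_pt_of_kind hI' _ (hn h)
      exact absurd hr (by simp)
    have hpi : posInf ∉ (J b).carrier := fun h => by
      obtain ⟨r, hr⟩ := eq_pt_of_kind hI _ (hi h)
      exact absurd hr (by simp)
    rw [hI, kind_eq_line hni hpi h2]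

/-- This replaces the pointwise matrices by a single pair of scalar matrices that does not depend on
`p`, as the rank argument requires. -/
lemma mul_eq_morphismScalar_mul (hF : IsMorphismMatrix ε I J F) (hG : IsMorphismMatrix ε J I G)
    {a a' : ι} (b : κ) (haa' : (I a).kind = (I a').kind) {p : Bipath} (hp : p ∈ (I a).carrier)
    (hp' : bipathAction.act ε (bipathAction.act ε p) ∈ (I a').carrier) :
    F p a b * G (bipathAction.act ε p) b a' =
      morphismScalar ε I J F a b * morphismScalar ε J I G b a' := by
  by_cases hab : (I a).kind = (J b).kind
  · by_cases hpJ : bipathAction.act ε p ∈ (J b).carrier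
    · rw [hF.morphismScalar_eq hab hp hpJ, hG.morphismScalar_eq (hab.symm.trans haa') hpJ hp']
    · have h0 : F p a b = 0 := by
        by_contra h
        exact hpJ (hF.support _ _ _ h).2
      rw [h0, zero_mul, eq_comm, mul_eq_zero]
      by_contra! h
      obtain ⟨-, q, hq⟩ := exists_of_morphismScalar_ne_zero h.1
      obtain ⟨-, r, hr⟩ := exists_of_morphismScalar_ne_zero h.2
      exact hpJ (hF.act_mem_of_ne_zero hG hab hq hr hp hp')
  · have h0 : F p a b * G (bipathAction.act ε p) b a' = 0 := by
      rw [mul_eq_zero]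
      by_contra! h
      exact hab (hF.kind_eq_of_ne_zero hG haa' h.1 h.2)
    have h1 : morphismScalar ε I J F a b = 0 := by
      by_contra h
      exact hab (exists_of_morphismScalar_ne_zero h).1
    rw [h0, h1, zero_mul]

open Classical in
/-- Hall's condition for the closeness relation between the intervals of interleaved modules. -/
lemma card_le_card_of_close (hF : IsMorphismMatrix ε I J F) (hG : IsMorphismMatrix ε J I G)
    (hfin : ∀ p, {b | p ∈ (J b).carrier}.Finite)
    (hGF : ∀ p a a', p ∈ (I a).carrier →
      bipathAction.act ε (bipathAction.act ε p) ∈ (I a').carrier → ∀ T : Finset κ,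
      (∀ b, bipathAction.act ε p ∈ (J b).carrier → b ∈ T) →
      ∑ b ∈ T, F p a b * G (bipathAction.act ε p) b a' = if a = a' then 1 else 0)
    {ε' : ℝ≥0} (hε : ε < ε') (S : Finset ι) (hS : ∀ a ∈ S, Significant ε' (I a)) (T : Finset κ)
    (hT : ∀ a ∈ S, ∀ b, Close ε' (I a) (J b) → b ∈ T) : S.card ≤ T.card := by
  refine card_le_card_of_triangular S T (morphismScalar ε I J F) (morphismScalar ε J I G)
    (fun a => score (I a)) fun a ha a' ha' hs => ?_
  have hzero : ∀ b, b ∉ T → morphismScalar ε I J F a b * morphismScalar ε J I G b a' = 0 := by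
    intro b hb
    rw [mul_eq_zero]
    by_contra! h
    rcases close_or_close hε (exists_of_morphismScalar_ne_zero h.1).1
      (exists_of_morphismScalar_ne_zero h.2).1 (hF.coordLE_of_morphismScalar_ne_zero h.1)
      (hG.coordLE_of_morphismScalar_ne_zero h.2) hs with hc | hc
    exacts [hb (hT a ha b hc), hb (hT a' ha' b hc)]
  -- If such a `p` exists, the product identity at `p` gives the sum, as entries outside `T`
  -- contribute nothing. If not, `a ≠ a'` by significance and every term vanishes by
  -- `exists_mem_act_mem`.
  by_cases hgood : (I a).kind = (I a').kind ∧ ∃ p ∈ (I a).carrier,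
      bipathAction.act ε (bipathAction.act ε p) ∈ (I a').carrier
  · obtain ⟨haa', p, hp, hp'⟩ := hgood
    rw [Finset.sum_subset (Finset.subset_union_left (s₂ := (hfin (bipathAction.act ε p)).toFinset))
      fun b _ hb => hzero b hb, ← hGF p a a' hp hp' _ fun b hb => Finset.mem_union_right _ ?_]
    · exact Finset.sum_congr rfl fun b _ => (hF.mul_eq_morphismScalar_mul hG b haa' hp hp').symm
    · simpa using hb
  · have hne : a ≠ a' := by
      rintro rfl
      obtain ⟨p, hp, hp'⟩ := hS a ha
      refine hgood ⟨rfl, p, hp, ?_⟩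
      refine (I a).convex _ hp _ hp' _ ?_ ?_
      · exact (bipathAction.le_act ε p).trans (bipathAction.le_act ε _)
      · rw [two_mul, bipathAction.act_add]
        have h : ∀ q, bipathAction.act ε q ≤ bipathAction.act ε' q := by
          rintro (_ | _ | ⟨i, r⟩)
          · simp
          · simp
          · simpa using hε.le
        exact (bipathAction.monotone ε (h p)).trans (h _)
    rw [if_neg hne]
    refine Finset.sum_eq_zero fun b _ => ?_
    rw [mul_eq_zero]
    by_contra! h
    have hab := (exists_of_morphismScalar_ne_zero h.1).1
    have hba' := (exists_of_morphismScalar_ne_zero h.2).1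
    exact hgood ⟨hab.trans hba', exists_mem_act_mem hε hab hba'
      (hF.coordLE_of_morphismScalar_ne_zero h.1) (hG.coordLE_of_morphismScalar_ne_zero h.2) hs
      (hS a ha) (hS a' ha')⟩

open Classical in
/-- The significant intervals of one of two interleaved modules can be matched injectively to close
intervals of the other one. -/
theorem exists_injective_close (hF : IsMorphismMatrix ε I J F) (hG : IsMorphismMatrix ε J I G)
    (hfin : ∀ p, {b | p ∈ (J b).carrier}.Finite)
    (hGF : ∀ p a a', p ∈ (I a).carrier →
      bipathAction.act ε (bipathAction.act ε p) ∈ (I a').carrier → ∀ T : Finset κ,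
      (∀ b, bipathAction.act ε p ∈ (J b).carrier → b ∈ T) →
      ∑ b ∈ T, F p a b * G (bipathAction.act ε p) b a' = if a = a' then 1 else 0)
    {ε' : ℝ≥0} (hε : ε < ε') :
    ∃ f : {a | Significant ε' (I a)} → κ, Function.Injective f ∧
      ∀ a : {a | Significant ε' (I a)}, Close ε' (I a) (J (f a)) := by
  have hfinite : ∀ a : {a | Significant ε' (I a)}, {b | Close ε' (I a) (J b)}.Finite := by
    rintro ⟨a, p, hp, hp'⟩
    exact (hfin (bipathAction.act ε' p)).subset fun b hb => Close.act_mem hb hp hp'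
  obtain ⟨f, hf, hf'⟩ := (Finset.all_card_le_biUnion_card_iff_exists_injective
    fun a => (hfinite a).toFinset).1 fun S => by
      have := hF.card_le_card_of_close hG hfin hGF hε (S.map (Function.Embedding.subtype _))
        (by simp only [Finset.mem_map]; rintro _ ⟨a, -, rfl⟩; exact a.2)
        (S.biUnion fun a => (hfinite a).toFinset) (by
          simp only [Finset.mem_map]
          rintro _ ⟨a, ha, rfl⟩ b hb
          exact Finset.mem_biUnion.2 ⟨a, ha, by simpa using hb⟩)
      rwa [Finset.card_map] at this
  exact ⟨f, hf, fun a => by simpa using hf' a⟩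

end IsMorphismMatrix

end InducedMatching

/-! ### From interleavings to matchings -/

section Interleaving

universe v

variable {k : Type u} [Field k] {V W : Bipath ⥤ ModuleCat.{v} k} {ε : ℝ≥0}

/-- A morphism from `V` to the `ε`-shift of `W`. -/
structure ShiftHom (ε : ℝ≥0) (V W : Bipath ⥤ ModuleCat.{v} k) where
  app : ∀ p, V.obj p →ₗ[k] W.obj (bipathAction.act ε p)
  naturality : ∀ p q (h : p ≤ q) x, app q (transition V h x) =
    transition W (bipathAction.monotone ε h) (app p x)

/-- The matrix entries of a morphism into a shift. -/
def ShiftHom.matrix (φ : ShiftHom ε V W) {ι κ : Type*} {I : ι → PosetInterval Bipath}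
    {J : κ → PosetInterval Bipath} (E : FrameSystem V I) (E' : FrameSystem W J)
    (p : Bipath) (a : ι) (b : κ) : k :=
  (E'.frame b).fn (bipathAction.act ε p) (φ.app p ((E.frame a).vec p))

variable {ι κ : Type*} {I : ι → PosetInterval Bipath} {J : κ → PosetInterval Bipath}
  (E : FrameSystem V I) (E' : FrameSystem W J)

lemma ShiftHom.isMorphismMatrix (φ : ShiftHom ε V W) :
    IsMorphismMatrix ε I J (φ.matrix E E') where
  support p a b h := by
    constructor <;> by_contra h'
    · exact h (by simp [matrix, (E.frame a).vec_eq_zero p h'])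
    · exact h (by simp [matrix, (E'.frame b).fn_eq_zero _ h'])
  naturality p q a b hpq hp hq := by
    rw [matrix, matrix, ← (E.frame a).transition_vec p q hpq hp, φ.naturality,
      (E'.frame b).fn_transition _ _ _ hq]

-- Expand the image of a generator in the spanning system of `W` and apply `ψ`. The composite is a
-- structure map of `V`, whose entries are those of the identity.
open Classical in
lemma ShiftHom.sum_matrix_mul_matrix [∀ p, Module.Finite k (W.obj p)] (φ : ShiftHom ε V W)
    (ψ : ShiftHom ε W V)
    (hψφ : ∀ p x, ψ.app _ (φ.app p x) =
      transition V ((bipathAction.le_act ε p).trans (bipathAction.le_act ε _)) x)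
    (hE' : E'.Spanning) (p : Bipath) (a a' : ι) (hp : p ∈ (I a).carrier)
    (hp' : bipathAction.act ε (bipathAction.act ε p) ∈ (I a').carrier) (T : Finset κ)
    (hT : ∀ b, bipathAction.act ε p ∈ (J b).carrier → b ∈ T) :
    ∑ b ∈ T, φ.matrix E E' p a b * ψ.matrix E' E (bipathAction.act ε p) b a' =
      if a = a' then 1 else 0 := by
  have h1 := hE'.eq_sum _ T hT (φ.app p ((E.frame a).vec p))
  have h2 := congrArg (fun x => (E.frame a').fn _ (ψ.app _ x)) h1
  simp only [map_sum, map_smul, smul_eq_mul] at h2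
  rw [hψφ, (E.frame a').fn_transition _ _ _ hp'] at h2
  refine h2.symm.trans ?_
  split_ifs with h
  · subst h
    exact (E.frame a).fn_vec p hp
  · exact E.fn_vec_of_ne a a' h p

end Interleaving

lemma isTrivial_of_not_significant {k : Type u} [Field k] {ε : ℝ≥0} {I : PosetInterval Bipath}
    (h : ¬ Significant ε I) : IsTrivial bipathAction (2 * ε) (intervalModule.{u, w} k I) := by
  intro p
  have h0 : intervalMap.{u, w} k I p (bipathAction.act (2 * ε) p) = 0 :=
    dif_neg fun hp => h ⟨p, hp.1, hp.2⟩
  exact congrArg ModuleCat.ofHom h0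

/-- The algebraic stability theorem for bipath persistence modules. -/
theorem bottleneckDist_le_of_interleaving {k : Type u} [Field k]
    {V W : Bipath ⥤ ModuleCat.{max u w} k} (hV : IsPFD.{u, w} V) (hW : IsPFD.{u, w} W) {ε : ℝ≥0}
    (φ : ShiftHom ε V W) (ψ : ShiftHom ε W V)
    (hψφ : ∀ p x, ψ.app _ (φ.app p x) =
      transition V ((bipathAction.le_act ε p).trans (bipathAction.le_act ε _)) x)
    (hφψ : ∀ p x, φ.app _ (ψ.app p x) =
      transition W ((bipathAction.le_act ε p).trans (bipathAction.le_act ε _)) x)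
    {A B : IntervalMultiset Bipath} (hA : IsPersistenceDiagram.{u, w} V A)
    (hB : IsPersistenceDiagram.{u, w} W B) :
    bottleneckDist.{u, w} bipathAction k A B ≤ ε := by
  have : ∀ p, Module.Finite k (V.obj p) := hV
  have : ∀ p, Module.Finite k (W.obj p) := hW
  obtain ⟨e⟩ := hA
  obtain ⟨e'⟩ := hB
  -- Closeness is only obtained for parameters strictly larger than `ε`, which suffices for an
  -- infimum.
  refine ENNReal.le_of_forall_pos_le_add fun δ hδ _ => ?_
  have hlt : ε < ε + δ := lt_add_of_pos_right ε hδ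
  let E := FrameSystem.ofIso e
  let E' := FrameSystem.ofIso e'
  have hE : E.Spanning := FrameSystem.spanning_ofIso e
  have hE' : E'.Spanning := FrameSystem.spanning_ofIso e'
  have hF := φ.isMorphismMatrix E E'
  have hG := ψ.isMorphismMatrix E' E
  obtain ⟨f, hf, hf'⟩ := hF.exists_injective_close hG (fun p => E'.finite_mem p)
    (φ.sum_matrix_mul_matrix E E' ψ hψφ hE') hlt
  obtain ⟨g, hg, hg'⟩ := hG.exists_injective_close hF (fun p => E.finite_mem p)
    (ψ.sum_matrix_mul_matrix E' E φ hφψ hE) hlt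
  obtain ⟨σ, hσ, hσA, hσB⟩ := exists_pequiv_covering_of_injective
    (fun (a : A.Elem) (b : B.Elem) => Close (ε + δ) a.1 b.1)
    _ _ f g hf hg hf' (fun b => (hg' b).symm)
  have hmatch : IsMatching.{u, w} bipathAction k (ε + δ) σ :=
    ⟨fun a ha => isTrivial_of_not_significant fun h => hσA a h ha,
      fun b hb => isTrivial_of_not_significant fun h => hσB b h hb, hσ⟩
  exact (iInf₂_le (ε + δ) ⟨σ, hmatch⟩).trans (by simp)

/-! ### Interleavings of sublevel set filtrations -/

namespace BipathFunction

section Sublevel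

variable {X : Type*} {f g : BipathFunction X}

lemma dist_comm (f g : BipathFunction X) : f.dist g = g.dist f := by
  have h : ∀ x y, bipathDist x y = bipathDist y x := by
    rintro (_ | _ | ⟨i, r⟩) (_ | _ | ⟨j, s⟩) <;> simp [bipathDist, abs_sub_comm, eq_comm]
  simp only [dist, h (f.toFun _ _)]

lemma bipathDist_le_dist (i : Fin 2) (x : X) :
    bipathDist (f.toFun i x) (g.toFun i x) ≤ f.dist g := by
  fin_cases i
  · exact (le_iSup (fun x => bipathDist (f.toFun 0 x) (g.toFun 0 x)) x).trans (le_max_left _ _)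
  · exact (le_iSup (fun x => bipathDist (f.toFun 1 x) (g.toFun 1 x)) x).trans (le_max_right _ _)

/-- Finite distance keeps values at ±∞ fixed and moves real values by at most `ε` on their line; the
assumption on the level sets handles `p = -∞`. -/
lemma sublevel_subset {ε : ℝ≥0}
    (hfg : f.toFun 0 ⁻¹' {Bipath.negInf} ⊆ g.toFun 0 ⁻¹' {Bipath.negInf})
    (hε : f.dist g ≤ ε) (p : Bipath) : f.sublevel p ⊆ g.sublevel (bipathAction.act ε p) := by
  intro x hx
  rcases p with _ | _ | ⟨i, r⟩
  · exact hfg hx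
  · trivial
  · have hd : bipathDist (f.toFun i x) (g.toFun i x) ≤ ε := (bipathDist_le_dist i x).trans hε
    change g.toFun i x ≤ .pt i (r + ε)
    have hx' : f.toFun i x ≤ .pt i r := hx
    generalize f.toFun i x = y at hd hx'
    rcases hgx : g.toFun i x with _ | _ | ⟨j, s⟩ <;> rw [hgx] at hd <;>
      rcases y with _ | _ | ⟨j', s'⟩
    · simp
    · simp
    · simp
    · simp [bipathDist] at hd
    · simp at hx'
    · simp [bipathDist] at hd
    · simp [bipathDist] at hd
    · simp at hx'
    · obtain ⟨rfl, h⟩ := pt_le_pt_iff.1 hx'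
      by_cases hj : j' = j
      · subst hj
        simp only [bipathDist, if_true] at hd
        have h1 : |s' - s| ≤ ε := by
          rwa [ENNReal.ofReal_le_iff_le_toReal ENNReal.coe_ne_top, ENNReal.coe_toReal] at hd
        have := (abs_le.1 h1).1
        simp only [pt_le_pt_iff, true_and]
        linarith
      · simp [bipathDist, hj] at hd

end Sublevel

variable {X : Type w} [TopologicalSpace X] {f g : BipathFunction X}

/-- The inclusion of sublevel sets, as a continuous map. -/
def sublevelInclusion {p q : Bipath} (h : f.sublevel p ⊆ g.sublevel q) :
    f.filtration.obj p ⟶ g.filtration.obj q :=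
  TopCat.ofHom ⟨Set.inclusion h, continuous_inclusion h⟩

/-- The shift morphism of bipath persistent homology induced by inclusions of sublevel sets. -/
def persistentHomologyShiftHom (k : Type u) [Field k] (q : ℕ) {ε : ℝ≥0}
    (h : ∀ p, f.sublevel p ⊆ g.sublevel (bipathAction.act ε p)) :
    ShiftHom ε (f.persistentHomology k q) (g.persistentHomology k q) where
  app p := (((AlgebraicTopology.singularHomologyFunctor (ModuleCat.{max u w} k) q).obj
      (ModuleCat.of k (ULift.{w} k))).map (sublevelInclusion (h p))).hom
  naturality p p' hp x := by
    have hcomp : f.filtration.map (homOfLE hp) ≫ sublevelInclusion (h p') =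
      sublevelInclusion (h p) ≫ g.filtration.map (homOfLE (bipathAction.monotone ε hp)) := rfl
    have := congrArg ((AlgebraicTopology.singularHomologyFunctor (ModuleCat.{max u w} k) q).obj
      (ModuleCat.of k (ULift.{w} k))).map hcomp
    rw [Functor.map_comp, Functor.map_comp] at this
    exact LinearMap.congr_fun (congrArg ModuleCat.Hom.hom this) x

lemma persistentHomologyShiftHom_comp (k : Type u) [Field k] (q : ℕ) {ε : ℝ≥0}
    (h : ∀ p, f.sublevel p ⊆ g.sublevel (bipathAction.act ε p))
    (h' : ∀ p, g.sublevel p ⊆ f.sublevel (bipathAction.act ε p)) (p : Bipath)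
    (x : (f.persistentHomology k q).obj p) :
    (persistentHomologyShiftHom k q h').app _ ((persistentHomologyShiftHom k q h).app p x) =
      transition (f.persistentHomology k q)
        ((bipathAction.le_act ε p).trans (bipathAction.le_act ε _)) x := by
  have hcomp : sublevelInclusion (h p) ≫ sublevelInclusion (h' (bipathAction.act ε p)) =
    f.filtration.map (homOfLE ((bipathAction.le_act ε p).trans (bipathAction.le_act ε _))) := rfl
  have := congrArg ((AlgebraicTopology.singularHomologyFunctor (ModuleCat.{max u w} k) q).obj
    (ModuleCat.of k (ULift.{w} k))).map hcomp
  rw [Functor.map_comp] at this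
  exact LinearMap.congr_fun (congrArg ModuleCat.Hom.hom this) x

end BipathFunction

end BipathPersistence

end

/-! ### The stability theorem -/

theorem theorem4p1 {k : Type u} [Field k] (q : ℕ) {X : Type w} [TopologicalSpace X]
    (f g : BipathPersistence.BipathFunction X)
    (hf : f.Tame k q) (hg : g.Tame k q)
    (hfg : f.toFun 0 ⁻¹' {BipathPersistence.Bipath.negInf} =
      g.toFun 0 ⁻¹' {BipathPersistence.Bipath.negInf}) :
    (∃ A, BipathPersistence.IsPersistenceDiagram.{u, w} (f.persistentHomology k q) A) ∧
    (∃ B, BipathPersistence.IsPersistenceDiagram.{u, w} (g.persistentHomology k q) B) ∧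
    ∀ A B : BipathPersistence.IntervalMultiset BipathPersistence.Bipath,
      BipathPersistence.IsPersistenceDiagram.{u, w} (f.persistentHomology k q) A →
      BipathPersistence.IsPersistenceDiagram.{u, w} (g.persistentHomology k q) B →
      BipathPersistence.bottleneckDist.{u, w} BipathPersistence.bipathAction k A B ≤
        BipathPersistence.BipathFunction.dist f g := by
  refine ⟨BipathPersistence.exists_isPersistenceDiagram_bipath _ hf,
    BipathPersistence.exists_isPersistenceDiagram_bipath _ hg, fun A B hA hB => ?_⟩
  by_cases htop : f.dist g = ⊤
  · rw [htop]
    exact le_top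
  lift f.dist g to ℝ≥0 using htop with ε hε
  have h := BipathPersistence.BipathFunction.sublevel_subset hfg.subset hε.symm.le
  have h' := BipathPersistence.BipathFunction.sublevel_subset hfg.symm.subset
    ((BipathPersistence.BipathFunction.dist_comm g f).trans hε.symm).le
  exact BipathPersistence.bottleneckDist_le_of_interleaving hf hg
    (BipathPersistence.BipathFunction.persistentHomologyShiftHom k q h)
    (BipathPersistence.BipathFunction.persistentHomologyShiftHom k q h')
    (BipathPersistence.BipathFunction.persistentHomologyShiftHom_comp k q h h')
    (BipathPersistence.BipathFunction.persistentHomologyShiftHom_comp k q h' h) hA hB
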